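/- Conventions. Let $(X,\mathscr A,\mu)$ be a $\sigma$-finite measure space and $\phi\colon X\to X$ a nonsingular transformation, i.e. $\phi$ is measurable and $\mu\circ\phi^{-1}\ll\mu$. The composition operator $C_\phi$ in the complex Hilbert space $L^2(\mu)$ is given by $\mathcal D(C_\phi)=\{f\in L^2(\mu): f\circ\phi\in L^2(\mu)\}$ and $C_\phi f=f\circ\phi$. Let $\phi^n$ denote the $n$-fold composition and $\mathsf h_{\phi^n}\colon X\to[0,\infty]$ the Radon–Nikodym derivative of $\mu\circ(\phi^n)^{-1}$ with respect to $\mu$. For an operator $A$ in a complex Hilbert space $\mathcal H$ put $\mathcal D^\infty(A)=\bigcap_{n\ge 0}\mathcal D(A^n)$. A real sequence $(\gamma_n)_{n\ge0}$ is a Stieltjes moment sequence if $\gamma_n=\int_{[0,\infty)}s^n\,d\rho(s)$ for all $n\ge 0$ and some positive Borel measure $\rho$ on $[0,\infty)$ (all these integrals being finite). The operator $A$ generates Stieltjes moment sequences if $\mathcal D^\infty(A)$ is dense in $\mathcal H$ and $(\|A^nf\|^2)_{n\ge0}$ is a Stieltjes moment sequence for every $f\in\mathcal D^\infty(A)$.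 A densely defined $A$ is hyponormal if $\mathcal D(A)\subseteq\mathcal D(A^*)$ and $\|A^*f\|\le\|Af\|$ for $f\in\mathcal D(A)$; normal if it is closed and $A^*A=AA^*$; subnormal if there are a complex Hilbert space $\mathcal K\supseteq\mathcal H$ (isometric embedding) and a normal operator $N$ in $\mathcal K$ with $\mathcal D(A)\subseteq\mathcal D(N)$ and $Af=Nf$ for $f\in\mathcal D(A)$. A subspace $\mathcal E\subseteq\mathcal D(A)$ is a core for $A$ if it is dense in $\mathcal D(A)$ with respect to the graph norm of $A$. Consider the following conditions on $C_\phi$: (i) $C_\phi$ generates Stieltjes moment sequences; (ii) $(\mathsf h_{\phi^n}(x))_{n\ge0}$ is a Stieltjes moment sequence for $\mu$-a.e. $x\in X$; (iii) $\mathcal D(C_\phi^k)$ is dense in $L^2(\mu)$ for all $k$, and $(\mu(\phi^{-n}(\Delta)))_{n\ge0}$ is a Stieltjes moment sequence for every $\Delta\in\mathscr A$ such that $\mu(\phi^{-k}(\Delta))<\infty$ for all $k\ge0$; (iv) $\mathsf h_{\phi^n}<\infty$ a.e. $[\mu]$ for all $n$, and $L(p)\ge0$ a.e. $[\mu]$ for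 every complex polynomial $p$ with $p(t)\ge0$ for all $t\in[0,\infty)$, where $L$ is the linear map from $\mathbb C[t]$ to the measurable complex functions on $X$ determined by $L(t^n)=\mathsf h_{\phi^n}$ (each $\mathsf h_{\phi^n}$ being modified on a null set so as to be finite); (v) for every $n\ge0$, $C_\phi^n=C_{\phi^n}$ and $\mathcal D^\infty(C_\phi)$ is a core for $C_\phi^n$. Theorem. (A) There exists a composition operator $C_\phi$ over a discrete measure space ($X=\mathbb N$ with all subsets measurable and $0<\mu(\{n\})<\infty$ for every $n$) that satisfies (i)–(v) but is not subnormal, and not even hyponormal. (B) There also exists a composition operator $C_\phi$ satisfying (i)–(v) that is neither subnormal nor hyponormal, with $X=[0,\infty)$, the Borel $\sigma$-algebra, and $\mu$ a $\sigma$-finite measure that is mutually absolutely continuous with Lebesgue measure. (C) Every composition operator (over any $\sigma$-finite measure space) that satisfies (i) satisfies (ii), (iii), (iv) and (v). (D) Consequently, for unbounded composition operators, none of the conditions (i), (ii), (iii), (iv), which are the analogues of Lambert's characterizations of subnormality of bounded composition operators, implies that $C_\phi$ is subnormal. -/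

import Mathlib

open MeasureTheory Measure Filter Topology
open scoped NNReal ENNReal ComplexOrder InnerProductSpace LinearPMap

universe u v

noncomputable section

/-! ### Unbounded operators in complex Hilbert spaces -/

namespace UnboundedOp

section Algebra

variable {E : Type*} [AddCommGroup E] [Module ℂ E]

/-- The product `B A` of two (partially defined) operators, on its natural domain
`{x ∈ D(A) : A x ∈ D(B)}`. -/
def prod (B A : E →ₗ.[ℂ] E) : E →ₗ.[ℂ] E where
  domain := (B.domain.comap A.toFun).map A.domain.subtype
  toFun :=
    { toFun := fun x => B ⟨A ⟨x.1, by
          obtain ⟨_, y, _, rfl⟩ := x; exact y.2⟩, by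
          obtain ⟨_, y, hy, rfl⟩ := x; exact hy⟩
      map_add' := fun x y => by
        rw [← LinearPMap.map_add]
        congr 1
        apply Subtype.ext
        exact A.map_add ⟨x.1, _⟩ ⟨y.1, _⟩
      map_smul' := fun c x => by
        rw [RingHom.id_apply, ← LinearPMap.map_smul]
        congr 1
        apply Subtype.ext
        exact A.map_smul c ⟨x.1, _⟩ }

theorem mem_prod_domain {B A : E →ₗ.[ℂ] E} {x : E} :
    x ∈ (prod B A).domain ↔ ∃ h : x ∈ A.domain, A ⟨x, h⟩ ∈ B.domain := by
  constructor
  · rintro ⟨y, hy, rfl⟩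
    exact ⟨y.2, hy⟩
  · rintro ⟨h, hx⟩
    exact ⟨⟨x, h⟩, hx, rfl⟩

theorem prod_apply {B A : E →ₗ.[ℂ] E} {x : E} (h : x ∈ A.domain)
    (h' : A ⟨x, h⟩ ∈ B.domain) :
    prod B A ⟨x, mem_prod_domain.2 ⟨h, h'⟩⟩ = B ⟨A ⟨x, h⟩, h'⟩ := rfl

/-- The powers `A ^ n` on their natural domains; `A ^ 0` is the identity on the whole space. -/
def pow (A : E →ₗ.[ℂ] E) : ℕ → (E →ₗ.[ℂ] E)
  | 0 => (LinearMap.id : E →ₗ[ℂ] E).toPMap ⊤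
  | n + 1 => prod A (pow A n)

/-- The space `D^∞(A)` of `C^∞`-vectors of `A`, the intersection of the domains of all powers. -/
def smoothVectors (A : E →ₗ.[ℂ] E) : Submodule ℂ E := ⨅ n : ℕ, (pow A n).domain

theorem mem_pow_domain {A : E →ₗ.[ℂ] E} {f : E} (hf : f ∈ smoothVectors A) (n : ℕ) :
    f ∈ (pow A n).domain := (Submodule.mem_iInf _).1 hf n

end Algebra

section Hilbert

variable {H : Type u} [NormedAddCommGroup H] [InnerProductSpace ℂ H]

/-- `S` is a core for `A`: a subspace of `D(A)` that is dense in `D(A)` for the graph norm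
`‖f‖_A ^ 2 = ‖f‖ ^ 2 + ‖A f‖ ^ 2`. -/
def IsCore (A : H →ₗ.[ℂ] H) (S : Submodule ℂ H) : Prop :=
  S ≤ A.domain ∧ ∀ f : A.domain, ∀ ε > 0, ∃ g : A.domain, (g : H) ∈ S ∧
    ‖((f - g : A.domain) : H)‖ ^ 2 + ‖A (f - g)‖ ^ 2 < ε

/-- A sequence of real numbers is a Stieltjes moment sequence if it is the sequence of (finite)
moments of a positive Borel measure on `[0, ∞)`. -/
def IsStieltjesMomentSeq (γ : ℕ → ℝ) : Prop :=
  ∃ ρ : Measure ℝ≥0, ∀ n : ℕ,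
    Integrable (fun s : ℝ≥0 => (s : ℝ) ^ n) ρ ∧ γ n = ∫ s : ℝ≥0, (s : ℝ) ^ n ∂ρ

/-- `A` generates Stieltjes moment sequences: its `C^∞`-vectors are dense and `‖A ^ n f‖ ^ 2`
is a Stieltjes moment sequence for each of them. -/
def GeneratesStieltjes (A : H →ₗ.[ℂ] H) : Prop :=
  Dense (smoothVectors A : Set H) ∧
    ∀ (f : H) (hf : f ∈ smoothVectors A),
      IsStieltjesMomentSeq fun n => ‖pow A n ⟨f, mem_pow_domain hf n⟩‖ ^ 2

variable [CompleteSpace H]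

/-- Normal operators: densely defined, closed, with `N* N = N N*` (including equality of the
domains). -/
def IsNormalOp (N : H →ₗ.[ℂ] H) : Prop :=
  Dense (N.domain : Set H) ∧ N.IsClosed ∧ prod N† N = prod N N†

/-- Hyponormal operators: densely defined, `D(A) ⊆ D(A*)` and `‖A* f‖ ≤ ‖A f‖` on `D(A)`. -/
def IsHyponormal (A : H →ₗ.[ℂ] H) : Prop :=
  Dense (A.domain : Set H) ∧
    ∀ f : A.domain, ∃ h : (f : H) ∈ A†.domain, ‖A† ⟨f, h⟩‖ ≤ ‖A f‖

end Hilbert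

/-- Subnormal operators: densely defined, with an extension to a normal operator in a complex
Hilbert space `K` (in the universe `v`) that contains the given one isometrically. -/
def IsSubnormal {H : Type u} [NormedAddCommGroup H] [InnerProductSpace ℂ H]
    (S : H →ₗ.[ℂ] H) : Prop :=
  Dense (S.domain : Set H) ∧
    ∃ (K : Type v) (_ : NormedAddCommGroup K) (_ : InnerProductSpace ℂ K) (_ : CompleteSpace K)
      (ι : H →ₗᵢ[ℂ] K) (N : K →ₗ.[ℂ] K), IsNormalOp N ∧
        ∀ f : S.domain, ∃ h : ι f ∈ N.domain, N ⟨ι f, h⟩ = ι (S f)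

end UnboundedOp

/-! ### Composition operators in `L²`-spaces -/

namespace CompositionOp

open UnboundedOp

variable {X : Type u} [MeasurableSpace X] {μ : Measure X} {φ : X → X}

/-- The composition operator `C_φ f = f ∘ φ` in `L²(μ)` with domain
`{f ∈ L²(μ) : f ∘ φ ∈ L²(μ)}`. The hypothesis says that `φ` is a nonsingular transformation:
`φ` is measurable and `μ ∘ φ⁻¹ ≪ μ`. -/
def compOp (hφ : QuasiMeasurePreserving φ μ μ) : Lp ℂ 2 μ →ₗ.[ℂ] Lp ℂ 2 μ where
  domain :=
    { carrier := {f | MemLp (fun x => f (φ x)) 2 μ}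
      add_mem' := fun {f g} hf hg => by
        refine (hf.add hg).ae_eq ?_
        exact (hφ.ae_eq_comp (Lp.coeFn_add f g)).symm
      zero_mem' := by
        refine (MemLp.zero (p := 2) (μ := μ) (ε := ℂ)).ae_eq ?_
        exact (hφ.ae_eq_comp (Lp.coeFn_zero ℂ 2 μ)).symm
      smul_mem' := fun c f hf => by
        refine (hf.const_smul c).ae_eq ?_
        exact (hφ.ae_eq_comp (Lp.coeFn_smul c f)).symm }
  toFun :=
    { toFun := fun f => MemLp.toLp (fun x => f.1 (φ x)) f.2
      map_add' := fun f g => by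
        rw [← MemLp.toLp_add]
        exact MemLp.toLp_congr _ _ (hφ.ae_eq_comp (Lp.coeFn_add f.1 g.1))
      map_smul' := fun c f => by
        rw [RingHom.id_apply, ← MemLp.toLp_const_smul]
        exact MemLp.toLp_congr _ _ (hφ.ae_eq_comp (Lp.coeFn_smul c f.1)) }

theorem mem_compOp_domain (hφ : QuasiMeasurePreserving φ μ μ) (f : Lp ℂ 2 μ) :
    f ∈ (compOp hφ).domain ↔ MemLp (fun x => f (φ x)) 2 μ := Iff.rfl

theorem coeFn_compOp (hφ : QuasiMeasurePreserving φ μ μ) (f : (compOp hφ).domain) :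
    (compOp hφ f : X → ℂ) =ᵐ[μ] fun x => f.1 (φ x) := MemLp.coeFn_toLp f.2

/-- The Radon-Nikodym derivative `h_{φ^n}` of `μ ∘ (φ^n)⁻¹` with respect to `μ`, with values in
`[0, ∞]`. -/
def rnDensity (μ : Measure X) (φ : X → X) (n : ℕ) : X → ℝ≥0∞ := (μ.map φ^[n]).rnDeriv μ

/-- `(h_{φ^n}(x))_n` is a Stieltjes moment sequence for `μ`-a.e. `x`. -/
def DensityCondition (μ : Measure X) (φ : X → X) : Prop :=
  ∀ᵐ x ∂μ, (∀ n, rnDensity μ φ n x < ∞) ∧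
    IsStieltjesMomentSeq fun n => (rnDensity μ φ n x).toReal

/-- All powers of `C_φ` are densely defined, and `(μ(φ^{-n}(Δ)))_n` is a Stieltjes moment sequence
for every measurable `Δ` for which all these numbers are finite. -/
def SetCondition (hφ : QuasiMeasurePreserving φ μ μ) : Prop :=
  (∀ k, Dense ((pow (compOp hφ) k).domain : Set (Lp ℂ 2 μ))) ∧
    ∀ Δ : Set X, MeasurableSet Δ → (∀ k, μ (φ^[k] ⁻¹' Δ) < ∞) →
      IsStieltjesMomentSeq fun n => (μ (φ^[n] ⁻¹' Δ)).toReal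

/-- The linear map `L` from complex polynomials to functions on `X` determined by
`L(t^n) = h_{φ^n}` (a possible value `∞` of `h_{φ^n}` being replaced by `0`). -/
def polyFunctional (μ : Measure X) (φ : X → X) (p : Polynomial ℂ) (x : X) : ℂ :=
  p.sum fun n a => a * ((rnDensity μ φ n x).toReal : ℂ)

/-- Every `h_{φ^n}` is finite a.e., and `L(p) ≥ 0` a.e. for each complex polynomial `p` with
`p(t) ≥ 0` for all real `t ≥ 0` (here `0 ≤ z` in `ℂ` means that `z` is real and nonnegative). -/
def PolynomialCondition (μ : Measure X) (φ : X → X) : Prop :=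
  (∀ n, ∀ᵐ x ∂μ, rnDensity μ φ n x < ∞) ∧
    ∀ p : Polynomial ℂ, (∀ t : ℝ, 0 ≤ t → 0 ≤ p.eval (t : ℂ)) →
      ∀ᵐ x ∂μ, 0 ≤ polyFunctional μ φ p x

/-- `C_φ ^ n = C_{φ^n}` and `D^∞(C_φ)` is a core for `C_φ ^ n`, for every `n ≥ 0`. -/
def PowerCoreCondition (hφ : QuasiMeasurePreserving φ μ μ) : Prop :=
  ∀ n, pow (compOp hφ) n = compOp (hφ.iterate n) ∧
    IsCore (pow (compOp hφ) n) (smoothVectors (compOp hφ))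

/-- `C_φ` generates Stieltjes moment sequences, meets the other moment conditions as well, and is
nevertheless neither hyponormal nor subnormal. -/
def IsLambertCounterexample (hφ : QuasiMeasurePreserving φ μ μ) : Prop :=
  GeneratesStieltjes (compOp hφ) ∧ DensityCondition μ φ ∧ SetCondition hφ ∧
    PolynomialCondition μ φ ∧ PowerCoreCondition hφ ∧
    ¬ IsSubnormal.{u, v} (compOp hφ) ∧ ¬ IsHyponormal (compOp hφ)

end CompositionOp

end

/-!
Fix a measure space and write `h n` for the density of `μ ∘ φ⁻ⁿ`.

*The moment conditions follow from generating Stieltjes moment sequences.* If the domain of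
`C_φ ^ n` is dense, then `h n` is a.e. finite, since functions in the domain vanish where it is
not. Indicator functions of sets `s` are the test functions:
`‖C_φ ^ n 1_s‖² = μ (φ⁻ⁿ s) = ∫_s h n`. Hence for a polynomial `p ≥ 0` on `[0, ∞)` the integral of
`L(p)` over `s` is `∫ p dρ ≥ 0`, where `ρ` represents this moment sequence, so `L(p) ≥ 0` a.e.
Countably many polynomials, those with rational coefficients, suffice to conclude that almost
every `(h n x)` is positive on the nonnegative polynomials, and
`StieltjesMoment.isStieltjesMomentSeq_of_nonneg` (M. Riesz extension and the Riesz representation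
theorem) provides a representing measure. Then `h k ≤ 1 + h n` for `k ≤ n`, which gives
`C_φ ^ n = C_{φ ^ n}`, and cutting functions off to sets on which every `h n` is bounded shows
that the `C^∞`-vectors form a core.

*The counterexample.* Subnormal and hyponormal operators both satisfy `|⟪f, A g⟫| ≤ ‖A f‖ ‖g‖`; in
the subnormal case this uses that the domain of `N* N` is a core for a normal `N`. To violate it,
take two discrete measures on `[0, ∞)`, the sums over `m ∈ ℤ` of the point masses
`8 ^ (-m (2 m + 1))` at `1 + 8 ^ (-2 m)` and at `1 + 8 ^ (2 m + 1)` respectively. A shift of `m`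
shows that all their moments of order `n ≥ 0` agree, but those of order `-1` do not. Consider the
tree in which infinitely many branches, indexed by `m`, meet a trunk at one vertex, and `φ` maps
each vertex to its parent. Give the vertices of the branch `m` the moments of the point mass at
`1 + 8 ^ (-2 m)`, and those of the trunk the moments of the second measure multiplied by negative
powers of `s`. The equality of the moments says precisely that the moments of a vertex are the
sums of those of its children (`BranchingTree.moment_succ`), hence that `h n` is a Stieltjes
moment sequence at each vertex. The inequality above fails for the indicator functions of the
first vertex of the branch `m = 0` and of the branching vertex, because the second measure has a
moment of order `-1` below `1 / 2`. The example on `[0, ∞)` replaces the vertices by unit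
intervals, which are translated onto each other.
-/

noncomputable section

/-! ### The Stieltjes moment problem -/

namespace StieltjesMoment

open Polynomial UnboundedOp

/-- The functions on `[0, ∞)` that are dominated by a polynomial. -/
def polyBounded : Submodule ℝ (ℝ≥0 → ℝ) where
  carrier := {f | ∃ p : ℝ[X], ∀ t : ℝ≥0, |f t| ≤ p.eval (t : ℝ)}
  add_mem' := by
    rintro f g ⟨p, hp⟩ ⟨q, hq⟩
    refine ⟨p + q, fun t => ?_⟩
    rw [eval_add]
    exact (abs_add_le _ _).trans (add_le_add (hp t) (hq t))
  zero_mem' := ⟨0, fun t => by simp⟩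
  smul_mem' := by
    rintro c f ⟨p, hp⟩
    refine ⟨C |c| * p, fun t => ?_⟩
    rw [eval_mul, eval_C, Pi.smul_apply, smul_eq_mul, abs_mul]
    exact mul_le_mul_of_nonneg_left (hp t) (abs_nonneg c)

theorem abs_eval_le (p : ℝ[X]) (t : ℝ≥0) :
    |p.eval (t : ℝ)| ≤ (p.sum fun n a => C |a| * X ^ n : ℝ[X]).eval (t : ℝ) := by
  rw [eval_eq_sum, Polynomial.sum, Polynomial.sum, eval_finsetSum]
  refine (Finset.abs_sum_le_sum_abs _ _).trans (Finset.sum_le_sum fun n _ => ?_)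
  rw [eval_mul, eval_C, eval_pow, eval_X, abs_mul, abs_of_nonneg (by positivity : (0:ℝ) ≤ (t:ℝ) ^ n)]

/-- Polynomials as polynomially bounded functions on `[0, ∞)`. -/
def evalMap : ℝ[X] →ₗ[ℝ] polyBounded where
  toFun p := ⟨fun t => p.eval (t : ℝ), _, abs_eval_le p⟩
  map_add' p q := by ext t; simp
  map_smul' c p := by ext t; simp

theorem evalMap_injective : Function.Injective evalMap := by
  intro p q h
  refine eq_of_infinite_eval_eq p q ((Set.Ici_infinite (0 : ℝ)).mono fun t ht => ?_)
  exact congrFun (congrArg Subtype.val h) ⟨t, ht⟩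

/-- The cone of nonnegative polynomially bounded functions. -/
def nonnegCone : PointedCone ℝ polyBounded where
  carrier := {f | ∀ t, 0 ≤ f.1 t}
  add_mem' := fun hf hg t => add_nonneg (hf t) (hg t)
  zero_mem' := fun _ => le_rfl
  smul_mem' := fun c _ hf t => mul_nonneg c.2 (hf t)

/-- The functional on polynomials that takes `X ^ n` to `γ n`. -/
def momentFunctional (γ : ℕ → ℝ) : ℝ[X] →ₗ[ℝ] ℝ :=
  Polynomial.lsum fun n => γ n • LinearMap.id

theorem momentFunctional_apply (γ : ℕ → ℝ) (p : ℝ[X]) :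
    momentFunctional γ p = p.sum fun n a => a * γ n := by
  simp [momentFunctional, mul_comm]

theorem momentFunctional_X_pow (γ : ℕ → ℝ) (n : ℕ) : momentFunctional γ (X ^ n) = γ n := by
  rw [momentFunctional_apply, ← monomial_one_right_eq_X_pow, sum_monomial_index _ _ (by simp)]
  simp

/-- A positive functional on polynomials extends to a positive functional on all
polynomially bounded functions, by the M. Riesz extension theorem. -/
theorem exists_positive_extension {γ : ℕ → ℝ}
    (hγ : ∀ p : ℝ[X], (∀ t : ℝ, 0 ≤ t → 0 ≤ p.eval t) → 0 ≤ p.sum fun n a => a * γ n) :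
    ∃ g : polyBounded →ₗ[ℝ] ℝ, (∀ n, g (evalMap (X ^ n)) = γ n) ∧
      ∀ f : polyBounded, (∀ t, 0 ≤ f.1 t) → 0 ≤ g f := by
  let e := LinearEquiv.ofInjective evalMap evalMap_injective
  let L : polyBounded →ₗ.[ℝ] ℝ :=
    { domain := LinearMap.range evalMap
      toFun := momentFunctional γ ∘ₗ (e.symm : _ →ₗ[ℝ] ℝ[X]) }
  have hL : ∀ p, L (e p) = momentFunctional γ p := fun p =>
    congrArg (momentFunctional γ) (e.symm_apply_apply p)
  have hpos : ∀ x : L.domain, (x : polyBounded) ∈ nonnegCone → 0 ≤ L x := by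
    intro x hx
    obtain ⟨p, rfl⟩ := e.surjective x
    rw [hL, momentFunctional_apply]
    exact hγ p fun t ht => hx ⟨t, ht⟩
  have hdense : ∀ y : polyBounded, ∃ x : L.domain, (x : polyBounded) + y ∈ nonnegCone := by
    rintro ⟨f, p, hp⟩
    refine ⟨e p, fun t => ?_⟩
    have := neg_abs_le (f t)
    have := hp t
    change 0 ≤ p.eval (t : ℝ) + f t
    linarith
  obtain ⟨g, hg, hg0⟩ := riesz_extension nonnegCone L hpos hdense
  refine ⟨g, fun n => ?_, hg0⟩
  rw [← momentFunctional_X_pow γ n, ← hL]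
  exact hg (e (X ^ n))

/-- A continuous cutoff function, equal to `1` on `[0, r]` and to `0` on `[r + 1, ∞)`. -/
def cutoff (r : ℕ) (t : ℝ≥0) : ℝ := max 0 (min 1 (r + 1 - (t : ℝ)))

theorem cutoff_nonneg (r : ℕ) (t : ℝ≥0) : 0 ≤ cutoff r t := le_max_left _ _

theorem cutoff_le_one (r : ℕ) (t : ℝ≥0) : cutoff r t ≤ 1 :=
  max_le zero_le_one (min_le_left _ _)

theorem cutoff_eq_one {r : ℕ} {t : ℝ≥0} (h : (t : ℝ) ≤ r) : cutoff r t = 1 := by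
  rw [cutoff, min_eq_left (by linarith), max_eq_right zero_le_one]

theorem cutoff_eq_zero {r : ℕ} {t : ℝ≥0} (h : (r + 1 : ℝ) ≤ t) : cutoff r t = 0 := by
  rw [cutoff, max_eq_left]
  exact (min_le_right _ _).trans (by linarith)

theorem continuous_cutoff (r : ℕ) : Continuous (cutoff r) := by
  unfold cutoff
  fun_prop

theorem cutoff_mono {r r' : ℕ} (h : r ≤ r') (t : ℝ≥0) : cutoff r t ≤ cutoff r' t := by
  have : (r : ℝ) ≤ r' := by exact_mod_cast h
  unfold cutoff
  gcongr

/-- The truncated power `t ^ n * cutoff r t`. -/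
def truncPow (n r : ℕ) : CompactlySupportedContinuousMap ℝ≥0 ℝ where
  toFun t := (t : ℝ) ^ n * cutoff r t
  continuous_toFun := by
    have := continuous_cutoff r
    fun_prop
  hasCompactSupport' := by
    refine HasCompactSupport.of_support_subset_isCompact (isCompact_Icc (a := 0) (b := (r + 1 : ℝ≥0)))
      fun t ht => ⟨zero_le, ?_⟩
    by_contra h
    refine ht ?_
    have : (r + 1 : ℝ) ≤ t := by
      have := (not_le.1 h).le
      exact_mod_cast this
    change (t : ℝ) ^ n * cutoff r t = 0
    rw [cutoff_eq_zero this, mul_zero]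

theorem truncPow_apply (n r : ℕ) (t : ℝ≥0) : truncPow n r t = (t : ℝ) ^ n * cutoff r t := rfl

/-- Compactly supported continuous functions are polynomially bounded. -/
def ofCompactSupport : CompactlySupportedContinuousMap ℝ≥0 ℝ →ₗ[ℝ] polyBounded where
  toFun f := ⟨f, by
    obtain ⟨c, hc⟩ := f.hasCompactSupport.exists_bound_of_continuous f.continuous
    exact ⟨C c, fun t => by simpa using hc t⟩⟩
  map_add' _ _ := rfl
  map_smul' _ _ := rfl

/-- Solution of the Stieltjes moment problem: a sequence is a Stieltjes moment sequence as soon as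
its moment functional is nonnegative on the polynomials that are nonnegative on `[0, ∞)`.
The representing measure is the Riesz measure of a positive extension; the truncation error of
`t ^ n` beyond `r` is at most `t ^ (n + 1) / r`, so no mass of a moment is lost. -/
theorem isStieltjesMomentSeq_of_nonneg {γ : ℕ → ℝ}
    (hγ : ∀ p : ℝ[X], (∀ t : ℝ, 0 ≤ t → 0 ≤ p.eval t) → 0 ≤ p.sum fun n a => a * γ n) :
    IsStieltjesMomentSeq γ := by
  obtain ⟨g, hg, hg0⟩ := exists_positive_extension hγ
  have hmono : ∀ f f' : polyBounded, (∀ t, f.1 t ≤ f'.1 t) → g f ≤ g f' := fun f f' h => by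
    rw [← sub_nonneg, ← map_sub]
    exact hg0 _ fun t => sub_nonneg.2 (h t)
  let Λ : CompactlySupportedContinuousMap ℝ≥0 ℝ →ₚ[ℝ] ℝ :=
    PositiveLinearMap.mk₀ (g ∘ₗ ofCompactSupport) fun f hf => hg0 _ hf
  have hΛ : ∀ f, ∫ t, f t ∂(RealRMK.rieszMeasure Λ) = g (ofCompactSupport f) := fun f =>
    RealRMK.integral_rieszMeasure Λ f
  set ρ := RealRMK.rieszMeasure Λ with hρ
  have hle : ∀ n r, g (ofCompactSupport (truncPow n r)) ≤ γ n := fun n r => by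
    rw [← hg n]
    refine hmono _ _ fun t => ?_
    change (t : ℝ) ^ n * cutoff r t ≤ (X ^ n : ℝ[X]).eval (t : ℝ)
    rw [eval_pow, eval_X]
    exact mul_le_of_le_one_right (by positivity) (cutoff_le_one r t)
  have hge : ∀ n (r : ℕ), 0 < r → γ n - γ (n + 1) / r ≤ g (ofCompactSupport (truncPow n r)) := by
    intro n r hr
    have hr' : (0 : ℝ) < r := by exact_mod_cast hr
    rw [div_eq_inv_mul, ← hg n, ← hg (n + 1), ← smul_eq_mul, ← map_smul, ← map_sub]
    refine hmono _ _ fun t => ?_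
    change (X ^ n : ℝ[X]).eval (t : ℝ) - (r : ℝ)⁻¹ * (X ^ (n + 1) : ℝ[X]).eval (t : ℝ) ≤
      (t : ℝ) ^ n * cutoff r t
    rw [eval_pow, eval_X, eval_pow, eval_X, pow_succ]
    rcases le_total (t : ℝ) r with h | h
    · rw [cutoff_eq_one h, mul_one, sub_le_self_iff]
      positivity
    · refine le_trans ?_ (mul_nonneg (by positivity) (cutoff_nonneg r t))
      rw [sub_nonpos, mul_left_comm]
      refine le_mul_of_one_le_right (by positivity) ?_
      rwa [← div_eq_inv_mul, one_le_div hr']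
  have htend : ∀ n, Tendsto (fun r => g (ofCompactSupport (truncPow n r))) atTop (𝓝 (γ n)) := by
    intro n
    refine tendsto_of_tendsto_of_tendsto_of_le_of_le' ?_ tendsto_const_nhds
      ((eventually_gt_atTop 0).mono fun r hr => hge n r hr) (Eventually.of_forall (hle n))
    simpa using tendsto_const_nhds.sub (tendsto_const_div_atTop_nhds_zero_nat (γ (n + 1)))
  have hint : ∀ n r, Integrable (truncPow n r) ρ := fun n r =>
    (truncPow n r).continuous.integrable_of_hasCompactSupport (truncPow n r).hasCompactSupport
  refine ⟨ρ, fun n => ?_⟩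
  have hlim : ∀ t : ℝ≥0, Tendsto (fun r => truncPow n r t) atTop (𝓝 ((t : ℝ) ^ n)) := fun t => by
    refine tendsto_const_nhds.congr' ?_
    obtain ⟨r₀, hr₀⟩ := exists_nat_ge (t : ℝ)
    filter_upwards [eventually_ge_atTop r₀] with r hr
    rw [truncPow_apply, cutoff_eq_one (hr₀.trans (by exact_mod_cast hr)), mul_one]
  have hmt : ∀ t : ℝ≥0, Monotone fun r => truncPow n r t := fun t r r' h =>
    mul_le_mul_of_nonneg_left (cutoff_mono h t) (by positivity)
  have hI : Integrable (fun s : ℝ≥0 => (s : ℝ) ^ n) ρ := by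
    refine ⟨by fun_prop, ?_⟩
    have h := lintegral_tendsto_of_tendsto_of_monotone (μ := ρ)
      (f := fun r t => ENNReal.ofReal (truncPow n r t)) (F := fun t => ENNReal.ofReal ((t : ℝ) ^ n))
      (fun r => (truncPow n r).continuous.measurable.ennreal_ofReal.aemeasurable)
      (Eventually.of_forall fun t _ _ h => ENNReal.ofReal_le_ofReal (hmt t h))
      (Eventually.of_forall fun t => ENNReal.tendsto_ofReal (hlim t))
    rw [hasFiniteIntegral_iff_ofReal (Eventually.of_forall fun t => by positivity)]
    refine (le_of_tendsto' h fun r => ?_).trans_lt (ENNReal.ofReal_lt_top (r := γ n))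
    rw [← ofReal_integral_eq_lintegral_ofReal (hint n r) (Eventually.of_forall fun t =>
      mul_nonneg (by positivity) (cutoff_nonneg r t)), hΛ]
    exact ENNReal.ofReal_le_ofReal (hle n r)
  refine ⟨hI, tendsto_nhds_unique (htend n) ?_⟩
  simp_rw [← hΛ]
  exact integral_tendsto_of_tendsto_of_monotone (hint n) hI (Eventually.of_forall hmt)
    (Eventually.of_forall hlim)

end StieltjesMoment

/-! ### Normal, subnormal and hyponormal operators -/

namespace UnboundedOp

section NormalOp

variable {K : Type*} [NormedAddCommGroup K] [InnerProductSpace ℂ K]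

/-- The graph of an operator as a subspace of the Hilbert space sum `K ⊕ K`. -/
def hilbertGraph (N : K →ₗ.[ℂ] K) : Submodule ℂ (WithLp 2 (K × K)) :=
  N.graph.comap (WithLp.linearEquiv 2 ℂ (K × K)).toLinearMap

theorem toLp_mem_hilbertGraph (N : K →ₗ.[ℂ] K) (u : N.domain) :
    WithLp.toLp 2 ((u : K), N u) ∈ hilbertGraph N := N.mem_graph u

theorem exists_of_mem_hilbertGraph {N : K →ₗ.[ℂ] K} {z : WithLp 2 (K × K)}
    (hz : z ∈ hilbertGraph N) : ∃ u : N.domain, z = WithLp.toLp 2 ((u : K), N u) := by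
  obtain ⟨u, h1, h2⟩ := N.mem_graph_iff.1 hz
  exact ⟨u, WithLp.ofLp_injective 2 (Prod.ext h1.symm h2.symm)⟩

theorem isClosed_hilbertGraph {N : K →ₗ.[ℂ] K} (hN : N.IsClosed) :
    IsClosed (hilbertGraph N : Set (WithLp 2 (K × K))) :=
  IsClosed.preimage (WithLp.prod_continuous_ofLp 2 K K) hN

variable [CompleteSpace K]

/-- For a closed, densely defined `N` the operator `1 + N* N` is onto: the solution of
`u + N* N u = h` is the first component of the projection of `(h, 0)` onto the graph of `N`. -/
theorem exists_add_adjoint_mul_self_eq {N : K →ₗ.[ℂ] K} (hd : Dense (N.domain : Set K))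
    (hN : N.IsClosed) (h : K) :
    ∃ (u : N.domain) (hu : N u ∈ N†.domain), (u : K) + N† ⟨N u, hu⟩ = h := by
  have : (hilbertGraph N).HasOrthogonalProjection := by
    have := (isClosed_hilbertGraph hN).completeSpace_coe
    infer_instance
  obtain ⟨p, hp, hp'⟩ := Submodule.HasOrthogonalProjection.exists_orthogonal
    (K := hilbertGraph N) (WithLp.toLp 2 (h, (0 : K)))
  obtain ⟨u, rfl⟩ := exists_of_mem_hilbertGraph hp
  have key : ∀ w : N.domain, ⟪h - u, (w : K)⟫_ℂ = ⟪N u, N w⟫_ℂ := fun w => by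
    have := (Submodule.mem_orthogonal' _ _).1 hp' _ (toLp_mem_hilbertGraph N w)
    rw [WithLp.prod_inner_apply] at this
    simp only [WithLp.ofLp_sub, Prod.fst_sub, Prod.snd_sub, zero_sub, inner_neg_left] at this
    exact add_neg_eq_zero.1 this
  have hu := LinearPMap.mem_adjoint_domain_of_exists (T := N) (N u) ⟨_, key⟩
  refine ⟨u, hu, ?_⟩
  rw [LinearPMap.adjoint_apply_eq hd ⟨N u, hu⟩ key, add_sub_cancel]

/-- The part of the graph of `N` over the domain of `N* N`. -/
def adjointMulSelfGraph (N : K →ₗ.[ℂ] K) : Submodule ℂ (WithLp 2 (K × K)) where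
  carrier := {z | ∃ u : N.domain, N u ∈ N†.domain ∧ z = WithLp.toLp 2 ((u : K), N u)}
  add_mem' := by
    rintro _ _ ⟨u, hu, rfl⟩ ⟨w, hw, rfl⟩
    refine ⟨u + w, ?_, ?_⟩
    · rw [LinearPMap.map_add]
      exact add_mem hu hw
    · rw [LinearPMap.map_add]
      rfl
  zero_mem' := ⟨0, by rw [LinearPMap.map_zero]; exact zero_mem _, by rw [LinearPMap.map_zero]; rfl⟩
  smul_mem' := by
    rintro c _ ⟨u, hu, rfl⟩
    refine ⟨c • u, ?_, ?_⟩
    · rw [LinearPMap.map_smul]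
      exact Submodule.smul_mem _ c hu
    · rw [LinearPMap.map_smul]
      rfl

/-- von Neumann: the domain of `N* N` is a core for a closed, densely defined `N`. -/
theorem hilbertGraph_le_closure {N : K →ₗ.[ℂ] K} (hd : Dense (N.domain : Set K))
    (hN : N.IsClosed) : hilbertGraph N ≤ (adjointMulSelfGraph N).topologicalClosure := by
  intro z hz
  obtain ⟨p, hp, hp'⟩ := Submodule.HasOrthogonalProjection.exists_orthogonal
    (K := (adjointMulSelfGraph N).topologicalClosure) z
  have hle : (adjointMulSelfGraph N).topologicalClosure ≤ hilbertGraph N := by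
    refine Submodule.topologicalClosure_minimal _ ?_ (isClosed_hilbertGraph hN)
    rintro _ ⟨u, -, rfl⟩
    exact toLp_mem_hilbertGraph N u
  obtain ⟨g, hg⟩ := exists_of_mem_hilbertGraph (sub_mem hz (hle hp))
  obtain ⟨u, hu, hug⟩ := exists_add_adjoint_mul_self_eq hd hN (g : K)
  -- The component `g` of `z` orthogonal to the graph over `D(N* N)` satisfies
  -- `⟪u + N* N u, g⟫ = 0` for all `u`, in particular for the `u` with `u + N* N u = g`.
  have horth := (Submodule.mem_orthogonal _ _).1 hp' _
    (Submodule.le_topologicalClosure _ ⟨u, hu, rfl⟩)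
  rw [hg, WithLp.prod_inner_apply] at horth
  change ⟪(u : K), (g : K)⟫_ℂ + ⟪N u, N g⟫_ℂ = 0 at horth
  rw [← LinearPMap.adjoint_isFormalAdjoint hd ⟨N u, hu⟩ g, ← inner_add_left, hug,
    inner_self_eq_zero] at horth
  have hg0 : g = 0 := Subtype.ext horth
  rw [hg0, LinearPMap.map_zero] at hg
  rw [sub_eq_zero.1 (show z - p = 0 from hg)]
  exact hp

/-- A normal `N` satisfies `‖N* u‖ = ‖N u‖` for `u` in the common domain of `N* N` and `N N*`. -/
theorem norm_adjoint_eq_of_mem {N : K →ₗ.[ℂ] K} (hN : IsNormalOp N) (u : N.domain)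
    (hu : N u ∈ N†.domain) : ∃ h : (u : K) ∈ N†.domain, ‖N† ⟨u, h⟩‖ = ‖N u‖ := by
  obtain ⟨hd, -, hcomm⟩ := hN
  have hu1 : (u : K) ∈ (prod N† N).domain := mem_prod_domain.2 ⟨u.2, hu⟩
  have hu2 : (u : K) ∈ (prod N N†).domain := hcomm ▸ hu1
  obtain ⟨h, h'⟩ := mem_prod_domain.1 hu2
  refine ⟨h, ?_⟩
  have heq : N† ⟨N u, hu⟩ = N ⟨N† ⟨u, h⟩, h'⟩ :=
    (LinearPMap.ext_iff.1 hcomm).2 (x := (u : K)) (hf := hu1) (hg := hu2)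
  have hfa := LinearPMap.adjoint_isFormalAdjoint hd
  have h1 : ⟪N† ⟨u, h⟩, N† ⟨u, h⟩⟫_ℂ = ⟪(u : K), N† ⟨N u, hu⟩⟫_ℂ := by
    rw [heq]
    exact hfa ⟨u, h⟩ ⟨N† ⟨u, h⟩, h'⟩
  have h2 : ⟪N u, N u⟫_ℂ = ⟪N† ⟨N u, hu⟩, (u : K)⟫_ℂ := (hfa ⟨N u, hu⟩ u).symm
  have h3 : ‖N† ⟨u, h⟩‖ ^ 2 = ‖N u‖ ^ 2 := by
    rw [← inner_self_eq_norm_sq (𝕜 := ℂ), ← inner_self_eq_norm_sq (𝕜 := ℂ), h1, h2,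
      ← inner_conj_symm, RCLike.conj_re]
  exact (sq_eq_sq₀ (norm_nonneg _) (norm_nonneg _)).1 h3

/-- The bound holds for `g` in the domain of `N* N` because `‖N* g‖ = ‖N g‖` there; both sides are
continuous in the graph norm, so it extends to the domain of `N`. -/
theorem IsNormalOp.norm_inner_le {N : K →ₗ.[ℂ] K} (hN : IsNormalOp N) (g x : N.domain) :
    ‖⟪(g : K), N x⟫_ℂ‖ ≤ ‖N g‖ * ‖(x : K)‖ := by
  have hg := hilbertGraph_le_closure hN.1 hN.2.1 (toLp_mem_hilbertGraph N g)
  let F : WithLp 2 (K × K) → ℝ := fun z => ‖z.snd‖ * ‖(x : K)‖ - ‖⟪z.fst, N x⟫_ℂ‖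
  have hF : Continuous F := by
    have h1 : Continuous fun z : WithLp 2 (K × K) => z.fst :=
      continuous_fst.comp (WithLp.prod_continuous_ofLp 2 K K)
    have h2 : Continuous fun z : WithLp 2 (K × K) => z.snd :=
      continuous_snd.comp (WithLp.prod_continuous_ofLp 2 K K)
    exact (h2.norm.mul continuous_const).sub (h1.inner continuous_const).norm
  have hcl : IsClosed {z | 0 ≤ F z} := isClosed_le continuous_const hF
  suffices hsub : (adjointMulSelfGraph N : Set (WithLp 2 (K × K))) ⊆ {z | 0 ≤ F z} by
    have h0 : 0 ≤ F (WithLp.toLp 2 ((g : K), N g)) := closure_minimal hsub hcl hg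
    exact sub_nonneg.1 h0
  rintro _ ⟨u, hu, rfl⟩
  obtain ⟨h, hnorm⟩ := norm_adjoint_eq_of_mem hN u hu
  change 0 ≤ ‖N u‖ * ‖(x : K)‖ - ‖⟪(u : K), N x⟫_ℂ‖
  rw [sub_nonneg, ← LinearPMap.adjoint_isFormalAdjoint hN.1 ⟨u, h⟩ x, ← hnorm]
  exact norm_inner_le_norm _ _

end NormalOp

/-- The necessary condition that both subnormal and hyponormal operators satisfy: the form
`⟪f, A g⟫` is bounded by `‖A f‖ ‖g‖`. -/
theorem IsSubnormal.norm_inner_le {H : Type u} [NormedAddCommGroup H] [InnerProductSpace ℂ H]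
    {A : H →ₗ.[ℂ] H} (hA : IsSubnormal.{u, v} A) (f g : A.domain) :
    ‖⟪(f : H), A g⟫_ℂ‖ ≤ ‖A f‖ * ‖(g : H)‖ := by
  obtain ⟨-, K, _, _, _, ι, N, hN, h⟩ := hA
  obtain ⟨hf, hf'⟩ := h f
  obtain ⟨hg, hg'⟩ := h g
  have := hN.norm_inner_le ⟨ι f, hf⟩ ⟨ι g, hg⟩
  rwa [hf', hg', ι.inner_map_map, ι.norm_map, ι.norm_map] at this

theorem IsHyponormal.norm_inner_le {H : Type u} [NormedAddCommGroup H] [InnerProductSpace ℂ H]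
    [CompleteSpace H] {A : H →ₗ.[ℂ] H} (hA : IsHyponormal A) (f g : A.domain) :
    ‖⟪(f : H), A g⟫_ℂ‖ ≤ ‖A f‖ * ‖(g : H)‖ := by
  obtain ⟨h, hle⟩ := hA.2 f
  rw [← LinearPMap.adjoint_isFormalAdjoint hA.1 ⟨f, h⟩ g]
  exact (norm_inner_le_norm _ _).trans (mul_le_mul_of_nonneg_right hle (norm_nonneg _))

end UnboundedOp

/-! ### Composition operators and their powers -/

namespace CompositionOp

open UnboundedOp

variable {X : Type u} [MeasurableSpace X] {μ : Measure X} {φ : X → X}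

theorem lintegral_enorm_sq_eq (f : Lp ℂ 2 μ) : ∫⁻ x, ‖f x‖ₑ ^ 2 ∂μ = ENNReal.ofReal (‖f‖ ^ 2) := by
  have h := eLpNorm_nnreal_pow_eq_lintegral (μ := μ) (f := f) (p := 2) two_ne_zero
  rw [ENNReal.ofReal_pow (norm_nonneg _), ofReal_norm, Lp.enorm_def]
  simpa using h.symm

theorem memLp_two_iff {f : X → ℂ} (hf : AEStronglyMeasurable f μ) :
    MemLp f 2 μ ↔ ∫⁻ x, ‖f x‖ₑ ^ 2 ∂μ < ∞ := by
  have h := eLpNorm_lt_top_iff_lintegral_rpow_enorm_lt_top (μ := μ) (f := f)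
    two_ne_zero ENNReal.ofNat_ne_top
  rw [MemLp, and_iff_right hf, h]
  simp

theorem measurable_rnDensity (n : ℕ) : Measurable (rnDensity μ φ n) := measurable_rnDeriv _ _

section Density

variable [SigmaFinite μ]

theorem lintegral_comp_iterate (hφ : QuasiMeasurePreserving φ μ μ) (n : ℕ)
    {g : X → ℝ≥0∞} (hg : AEMeasurable g μ) :
    ∫⁻ x, g (φ^[n] x) ∂μ = ∫⁻ x, rnDensity μ φ n x * g x ∂μ := by
  have hac := (hφ.iterate n).absolutelyContinuous
  rw [rnDensity, lintegral_rnDeriv_mul hac hg,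
    lintegral_map' (hg.mono_ac hac) (hφ.iterate n).measurable.aemeasurable]

theorem measure_preimage_iterate (hφ : QuasiMeasurePreserving φ μ μ) (n : ℕ)
    {s : Set X} (hs : MeasurableSet s) :
    μ (φ^[n] ⁻¹' s) = ∫⁻ x in s, rnDensity μ φ n x ∂μ := by
  rw [rnDensity, setLIntegral_rnDeriv' (hφ.iterate n).absolutelyContinuous hs,
    map_apply (hφ.iterate n).measurable hs]

theorem rnDensity_zero : rnDensity μ φ 0 =ᵐ[μ] 1 := by
  rw [rnDensity, Function.iterate_zero, Measure.map_id]
  exact rnDeriv_self μ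

theorem memLp_comp_iterate_iff (hφ : QuasiMeasurePreserving φ μ μ) (n : ℕ)
    (f : Lp ℂ 2 μ) :
    MemLp (fun x => f (φ^[n] x)) 2 μ ↔ ∫⁻ x, rnDensity μ φ n x * ‖f x‖ₑ ^ 2 ∂μ < ∞ := by
  have hm : AEStronglyMeasurable (fun x => f (φ^[n] x)) μ :=
    (Lp.aestronglyMeasurable f).comp_quasiMeasurePreserving (hφ.iterate n)
  rw [memLp_two_iff hm, ← lintegral_comp_iterate hφ n (g := fun x => ‖f x‖ₑ ^ 2)
      ((Lp.aestronglyMeasurable f).enorm.pow_const 2)]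

end Density

section Powers

variable (hφ : QuasiMeasurePreserving φ μ μ)

theorem pow_compOp_aux (n : ℕ) :
    (∀ f : Lp ℂ 2 μ, f ∈ (pow (compOp hφ) n).domain ↔
      ∀ k ≤ n, MemLp (fun x => f (φ^[k] x)) 2 μ) ∧
    ∀ f : (pow (compOp hφ) n).domain,
      (pow (compOp hφ) n f : X → ℂ) =ᵐ[μ] fun x => f.1 (φ^[n] x) := by
  induction n with
  | zero =>
    refine ⟨fun f => ⟨fun _ k hk => ?_, fun _ => Submodule.mem_top⟩, fun f => ae_eq_rfl⟩
    rw [Nat.le_zero.1 hk]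
    exact Lp.memLp f
  | succ n ih =>
    have hae : ∀ f (h : f ∈ (pow (compOp hφ) n).domain),
        (fun x => pow (compOp hφ) n ⟨f, h⟩ (φ x)) =ᵐ[μ] fun x => f (φ^[n + 1] x) := fun f h =>
      hφ.ae_eq_comp (ih.2 ⟨f, h⟩)
    refine ⟨fun f => ?_, fun f => ?_⟩
    · refine Iff.trans mem_prod_domain ⟨?_, fun H => ?_⟩
      · rintro ⟨h, h'⟩ k hk
        rcases Nat.le_succ_iff.1 hk with hk | rfl
        · exact (ih.1 f).1 h k hk
        · exact MemLp.ae_eq (hae f h) h'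
      · have h : f ∈ (pow (compOp hφ) n).domain := (ih.1 f).2 fun k hk => H k (hk.trans n.le_succ)
        exact ⟨h, MemLp.ae_eq (hae f h).symm (H _ le_rfl)⟩
    · obtain ⟨f, hf⟩ := f
      obtain ⟨h, h'⟩ := mem_prod_domain.1 hf
      exact (coeFn_compOp hφ ⟨_, h'⟩).trans (hae f h)

theorem mem_pow_compOp_domain {n : ℕ} {f : Lp ℂ 2 μ} :
    f ∈ (pow (compOp hφ) n).domain ↔ ∀ k ≤ n, MemLp (fun x => f (φ^[k] x)) 2 μ :=
  (pow_compOp_aux hφ n).1 f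

theorem coeFn_pow_compOp (n : ℕ) (f : (pow (compOp hφ) n).domain) :
    (pow (compOp hφ) n f : X → ℂ) =ᵐ[μ] fun x => f.1 (φ^[n] x) :=
  (pow_compOp_aux hφ n).2 f

theorem mem_smoothVectors_compOp {f : Lp ℂ 2 μ} :
    f ∈ smoothVectors (compOp hφ) ↔ ∀ k, MemLp (fun x => f (φ^[k] x)) 2 μ := by
  refine (Submodule.mem_iInf _).trans ⟨fun h k => ?_, fun h n => ?_⟩
  · exact (mem_pow_compOp_domain hφ).1 (h k) k le_rfl
  · exact (mem_pow_compOp_domain hφ).2 fun k _ => h k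

theorem ofReal_norm_pow_compOp_sq [SigmaFinite μ] (n : ℕ) (f : (pow (compOp hφ) n).domain) :
    ENNReal.ofReal (‖pow (compOp hφ) n f‖ ^ 2) =
      ∫⁻ x, rnDensity μ φ n x * ‖f.1 x‖ₑ ^ 2 ∂μ := by
  rw [← lintegral_enorm_sq_eq, ← lintegral_comp_iterate hφ n (g := fun x => ‖f.1 x‖ₑ ^ 2)
      ((Lp.aestronglyMeasurable f.1).enorm.pow_const 2)]
  refine lintegral_congr_ae ?_
  filter_upwards [coeFn_pow_compOp hφ n f] with x hx
  rw [hx]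

end Powers

section Truncation

/-- For a finite measure, countably many a.e. finite functions are simultaneously bounded off a
set of small measure. -/
theorem exists_measurableSet_forall_le {ν : Measure X} [IsFiniteMeasure ν] {h : ℕ → X → ℝ≥0∞}
    (hm : ∀ k, Measurable (h k)) (hfin : ∀ k, ∀ᵐ x ∂ν, h k x < ∞) {ε : ℝ≥0∞} (hε : ε ≠ 0) :
    ∃ (s : Set X) (N : ℕ → ℕ), MeasurableSet s ∧ ν sᶜ < ε ∧ ∀ x ∈ s, ∀ k, h k x < N k := by
  obtain ⟨ε', hε', hsum⟩ := ENNReal.exists_pos_sum_of_countable hε ℕ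
  have hN : ∀ k, ∃ N : ℕ, ν {x | (N : ℝ≥0∞) ≤ h k x} < ε' k := fun k => by
    have ht := tendsto_measure_iInter_atTop (μ := ν) (s := fun N : ℕ => {x | (N : ℝ≥0∞) ≤ h k x})
      (fun N => (measurableSet_le measurable_const (hm k)).nullMeasurableSet)
      (fun N N' hNN x (hx : (N' : ℝ≥0∞) ≤ h k x) =>
        (Nat.cast_le.2 hNN).trans hx) ⟨0, measure_ne_top _ _⟩
    have h0 : ν (⋂ N : ℕ, {x | (N : ℝ≥0∞) ≤ h k x}) = 0 := by
      refine measure_mono_null (fun x hx => ?_) (hfin k)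
      intro hlt
      obtain ⟨N, hN⟩ := ENNReal.exists_nat_gt hlt.ne
      exact absurd (Set.mem_iInter.1 hx N) (not_le.2 hN)
    rw [h0] at ht
    exact (ht.eventually_lt_const (ENNReal.coe_pos.2 (hε' k))).exists
  choose N hN using hN
  refine ⟨⋂ k, {x | h k x < N k}, N, MeasurableSet.iInter fun k =>
    measurableSet_lt (hm k) measurable_const, ?_, fun x hx k => Set.mem_iInter.1 hx k⟩
  refine lt_of_le_of_lt ?_ hsum
  rw [Set.compl_iInter]
  refine (measure_iUnion_le _).trans (ENNReal.tsum_le_tsum fun k => ?_)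
  refine le_trans (measure_mono fun x hx => ?_) (hN k).le
  exact not_lt.1 (show ¬ h k x < N k from hx)

variable [SigmaFinite μ]

/-- To prove an assertion a.e. it suffices to do so on the sets of finite measure on which every
`h_{φ^k}` is bounded. -/
theorem ae_of_forall_rnDensity_bounded (hfin : ∀ n, ∀ᵐ x ∂μ, rnDensity μ φ n x < ∞) {P : X → Prop}
    (hP : ∀ (s : Set X) (N : ℕ → ℕ), MeasurableSet s → μ s < ∞ →
      (∀ x ∈ s, ∀ k, rnDensity μ φ k x < N k) → ∀ᵐ x ∂μ.restrict s, P x) : ∀ᵐ x ∂μ, P x := by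
  refine ae_of_forall_measure_lt_top_ae_restrict P fun t ht htfin => ?_
  have : IsFiniteMeasure (μ.restrict t) := ⟨by rwa [restrict_apply_univ]⟩
  refine le_antisymm (ENNReal.le_of_forall_pos_le_add fun ε hε _ => ?_) zero_le
  obtain ⟨s, N, hs, hsε, hsN⟩ := exists_measurableSet_forall_le (ν := μ.restrict t)
    (h := rnDensity μ φ) measurable_rnDensity (fun k => ae_restrict_of_ae (hfin k))
    (ENNReal.coe_ne_zero.2 hε.ne')
  have h := hP (s ∩ t) N (hs.inter ht) ((measure_mono Set.inter_subset_right).trans_lt htfin)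
    fun x hx => hsN x hx.1
  rw [← restrict_restrict hs] at h
  have h0 : μ.restrict t ({x | ¬ P x} ∩ s) = 0 := by
    have := ae_iff.1 h
    rwa [restrict_apply₀' hs.nullMeasurableSet] at this
  rw [zero_add]
  calc μ.restrict t {x | ¬ P x} ≤ μ.restrict t ({x | ¬ P x} ∩ s ∪ sᶜ) := by
        refine measure_mono fun x hx => ?_
        by_cases hxs : x ∈ s
        · exact Or.inl ⟨hx, hxs⟩
        · exact Or.inr hxs
    _ ≤ μ.restrict t ({x | ¬ P x} ∩ s) + μ.restrict t sᶜ := measure_union_le _ _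
    _ ≤ ε := by rw [h0, zero_add]; exact hsε.le

/-- If all `h_{φ^n}` are finite, then cutting `f` off to sets where all of them are bounded
approximates `f` in the graph norm of `C_φ ^ n` by `C^∞`-vectors. -/
theorem isCore_smoothVectors (hφ : QuasiMeasurePreserving φ μ μ)
    (hfin : ∀ n, ∀ᵐ x ∂μ, rnDensity μ φ n x < ∞) (n : ℕ) :
    IsCore (pow (compOp hφ) n) (smoothVectors (compOp hφ)) := by
  refine ⟨iInf_le _ n, fun f ε hε => ?_⟩
  let F : X → ℝ≥0∞ := fun x => ‖f.1 x‖ₑ ^ 2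
  have hF : AEMeasurable F μ := (Lp.aestronglyMeasurable f.1).enorm.pow_const 2
  have hF0 : ∫⁻ x, F x ∂μ < ∞ := by
    rw [lintegral_enorm_sq_eq]
    exact ENNReal.ofReal_lt_top
  have hFn : ∫⁻ x, rnDensity μ φ n x * F x ∂μ < ∞ := by
    rw [← ofReal_norm_pow_compOp_sq hφ n f]
    exact ENNReal.ofReal_lt_top
  -- `ν sᶜ` is the squared graph norm of the part of `f` over `sᶜ`.
  let ν := μ.withDensity fun x => F x + rnDensity μ φ n x * F x
  have : IsFiniteMeasure ν := by
    refine isFiniteMeasure_withDensity ?_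
    rw [lintegral_add_left' hF]
    exact (ENNReal.add_lt_top.2 ⟨hF0, hFn⟩).ne
  obtain ⟨s, N, hs, hsε, hsN⟩ := exists_measurableSet_forall_le (ν := ν) (h := rnDensity μ φ)
    measurable_rnDensity (fun k => (withDensity_absolutelyContinuous _ _).ae_le (hfin k))
    (ENNReal.ofReal_pos.2 hε).ne'
  obtain ⟨g, hg⟩ : ∃ g : Lp ℂ 2 μ, g =ᵐ[μ] s.indicator f.1 :=
    ⟨_, ((Lp.memLp f.1).indicator hs).coeFn_toLp⟩
  have hgs : g ∈ smoothVectors (compOp hφ) := by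
    refine (mem_smoothVectors_compOp hφ).2 fun k => (memLp_comp_iterate_iff hφ k g).2 ?_
    calc ∫⁻ x, rnDensity μ φ k x * ‖g x‖ₑ ^ 2 ∂μ ≤ ∫⁻ x, N k * F x ∂μ := by
          refine lintegral_mono_ae ?_
          filter_upwards [hg] with x hx
          rw [hx]
          by_cases hxs : x ∈ s
          · rw [Set.indicator_of_mem hxs]
            exact mul_le_mul_left (hsN x hxs k).le _
          · rw [Set.indicator_of_notMem hxs]
            simp
      _ < ∞ := by
          rw [lintegral_const_mul'' _ hF]
          exact ENNReal.mul_lt_top (ENNReal.natCast_lt_top _) hF0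
  refine ⟨⟨g, mem_pow_domain hgs n⟩, hgs, ?_⟩
  obtain ⟨d, hd'⟩ : ∃ d, d = f - ⟨g, mem_pow_domain hgs n⟩ := ⟨_, rfl⟩
  have hdc : (d : Lp ℂ 2 μ) = f.1 - g := by rw [hd']; rfl
  rw [← hd', ← ENNReal.ofReal_lt_ofReal_iff hε, ENNReal.ofReal_add (by positivity) (by positivity),
    ofReal_norm_pow_compOp_sq, ← lintegral_enorm_sq_eq]
  have hd : ∀ᵐ x ∂μ, ‖d.1 x‖ₑ ^ 2 = sᶜ.indicator F x := by
    filter_upwards [Lp.coeFn_sub f.1 g, hg] with x h1 h2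
    rw [hdc, h1, Pi.sub_apply, h2]
    by_cases hxs : x ∈ s
    · rw [Set.indicator_of_mem hxs, Set.indicator_of_notMem (by simpa using hxs)]
      simp
    · rw [Set.indicator_of_notMem hxs, Set.indicator_of_mem (by simpa using hxs), sub_zero]
  refine lt_of_eq_of_lt ?_ hsε
  rw [withDensity_apply _ hs.compl, ← lintegral_indicator hs.compl, ← lintegral_add_left']
  · refine lintegral_congr_ae ?_
    filter_upwards [hd] with x hx
    rw [hx]
    by_cases hxs : x ∈ sᶜ
    · simp [Set.indicator_of_mem hxs]
    · simp [Set.indicator_of_notMem hxs]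
  · exact (Lp.aestronglyMeasurable d.1).enorm.pow_const 2

theorem dense_smoothVectors (hφ : QuasiMeasurePreserving φ μ μ)
    (hfin : ∀ n, ∀ᵐ x ∂μ, rnDensity μ φ n x < ∞) :
    Dense (smoothVectors (compOp hφ) : Set (Lp ℂ 2 μ)) := by
  refine Metric.dense_iff.2 fun f r hr => ?_
  obtain ⟨g, hg, h⟩ := (isCore_smoothVectors hφ hfin 0).2 ⟨f, Submodule.mem_top⟩ (r ^ 2)
    (by positivity)
  refine ⟨g, ?_, hg⟩
  rw [Metric.mem_ball, dist_comm, dist_eq_norm]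
  refine lt_of_pow_lt_pow_left₀ 2 hr.le ((le_add_of_nonneg_right ?_).trans_lt h)
  positivity

/-- Conversely, functions in the domain of `C_φ ^ n` vanish where `h_{φ^n}` is infinite. -/
theorem rnDensity_lt_top_of_dense (hφ : QuasiMeasurePreserving φ μ μ)
    {n : ℕ} (hd : Dense ((pow (compOp hφ) n).domain : Set (Lp ℂ 2 μ))) :
    ∀ᵐ x ∂μ, rnDensity μ φ n x < ∞ := by
  refine ae_of_forall_measure_lt_top_ae_restrict _ fun t ht htfin => ?_
  let s := t ∩ {x | rnDensity μ φ n x = ∞}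
  have hs : MeasurableSet s := ht.inter (measurable_rnDensity n (measurableSet_singleton ∞))
  have hsfin : μ s ≠ ∞ := ((measure_mono Set.inter_subset_left).trans_lt htfin).ne
  let e : Lp ℂ 2 μ := indicatorConstLp 2 hs hsfin 1
  have horth : ∀ f ∈ (pow (compOp hφ) n).domain, ⟪e, f⟫_ℂ = 0 := by
    intro f hf
    have hlt := (memLp_comp_iterate_iff hφ n f).1 ((mem_pow_compOp_domain hφ).1 hf n le_rfl)
    have hae := ae_lt_top' ((measurable_rnDensity n).aemeasurable.mul
      ((Lp.aestronglyMeasurable f).enorm.pow_const 2)) hlt.ne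
    rw [L2.inner_indicatorConstLp_one hs hsfin]
    refine setIntegral_eq_zero_of_ae_eq_zero ?_
    filter_upwards [hae] with x hx hxs
    -- Where `h_{φ^n} = ∞`, a nonzero value of `f` would make the finite energy infinite.
    by_contra h0
    rw [Pi.mul_apply, hxs.2, ENNReal.top_mul (by simpa using h0)] at hx
    exact lt_irrefl _ hx
  have he : e = 0 :=
    hd.eq_zero_of_inner_left ℂ horth
  have hs0 : μ s = 0 := by
    have := norm_indicatorConstLp (p := 2) (hs := hs) (hμs := hsfin) (c := (1 : ℂ)) two_ne_zero
      ENNReal.ofNat_ne_top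
    change ‖e‖ = _ at this
    rw [he, norm_zero, norm_one, one_mul, eq_comm, Real.rpow_eq_zero measureReal_nonneg
      (by simp), measureReal_eq_zero_iff hsfin] at this
    exact this
  rw [ae_iff, restrict_apply₀' ht.nullMeasurableSet]
  refine measure_mono_null (fun x hx => ?_) hs0
  exact ⟨hx.2, not_lt_top_iff.1 hx.1⟩

end Truncation

end CompositionOp

/-! ### Consequences of generating Stieltjes moment sequences -/

namespace CompositionOp

open UnboundedOp Polynomial

variable {X : Type u} [MeasurableSpace X] {μ : Measure X} {φ : X → X}

theorem lintegral_rnDensity_mul_indicatorConstLp [SigmaFinite μ]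
    (hφ : QuasiMeasurePreserving φ μ μ) (n : ℕ) {s : Set X} (hs : MeasurableSet s)
    (hsfin : μ s ≠ ∞) :
    ∫⁻ x, rnDensity μ φ n x * ‖indicatorConstLp 2 hs hsfin (1 : ℂ) x‖ₑ ^ 2 ∂μ =
      μ (φ^[n] ⁻¹' s) := by
  rw [measure_preimage_iterate hφ n hs, ← lintegral_indicator hs]
  refine lintegral_congr_ae ?_
  filter_upwards [indicatorConstLp_coeFn (p := 2) (hs := hs) (hμs := hsfin) (c := (1 : ℂ))]
    with x hx
  rw [hx]
  by_cases hxs : x ∈ s <;> simp [hxs]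

theorem indicatorConstLp_mem_smoothVectors [SigmaFinite μ] (hφ : QuasiMeasurePreserving φ μ μ)
    {s : Set X} (hs : MeasurableSet s) (hsfin : μ s ≠ ∞) (hfin : ∀ k, μ (φ^[k] ⁻¹' s) < ∞) :
    indicatorConstLp 2 hs hsfin (1 : ℂ) ∈ smoothVectors (compOp hφ) := by
  refine (mem_smoothVectors_compOp hφ).2 fun k => (memLp_comp_iterate_iff hφ k _).2 ?_
  rw [lintegral_rnDensity_mul_indicatorConstLp hφ]
  exact hfin k

section Generates

variable {hφ : QuasiMeasurePreserving φ μ μ}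

theorem _root_.UnboundedOp.GeneratesStieltjes.isStieltjesMomentSeq_measure_preimage
    [SigmaFinite μ] (hG : GeneratesStieltjes (compOp hφ))
    {s : Set X} (hs : MeasurableSet s) (hfin : ∀ k, μ (φ^[k] ⁻¹' s) < ∞) :
    IsStieltjesMomentSeq fun n => (μ (φ^[n] ⁻¹' s)).toReal := by
  have hsfin : μ s ≠ ∞ := (hfin 0).ne
  convert hG.2 _ (indicatorConstLp_mem_smoothVectors hφ hs hsfin hfin) using 2 with n
  rw [← ENNReal.toReal_ofReal (sq_nonneg _), ofReal_norm_pow_compOp_sq,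
    lintegral_rnDensity_mul_indicatorConstLp hφ]

theorem _root_.UnboundedOp.GeneratesStieltjes.dense_pow_domain
    (hG : GeneratesStieltjes (compOp hφ)) (n : ℕ) :
    Dense ((pow (compOp hφ) n).domain : Set (Lp ℂ 2 μ)) :=
  hG.1.mono (iInf_le (fun n => (pow (compOp hφ) n).domain) n)

theorem _root_.UnboundedOp.GeneratesStieltjes.rnDensity_lt_top
    [SigmaFinite μ] (hG : GeneratesStieltjes (compOp hφ)) (n : ℕ) : ∀ᵐ x ∂μ, rnDensity μ φ n x < ∞ :=
  rnDensity_lt_top_of_dense hφ (hG.dense_pow_domain n)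

theorem _root_.UnboundedOp.GeneratesStieltjes.setCondition
    [SigmaFinite μ] (hG : GeneratesStieltjes (compOp hφ)) : SetCondition hφ :=
  ⟨hG.dense_pow_domain, fun _ hs hfin => hG.isStieltjesMomentSeq_measure_preimage hs hfin⟩

end Generates

theorem ae_nonneg_of_forall_setIntegral_nonneg_complex {f : X → ℂ} (hf : Integrable f μ)
    (h : ∀ s, MeasurableSet s → 0 ≤ ∫ x in s, f x ∂μ) : ∀ᵐ x ∂μ, 0 ≤ f x := by
  have hre : 0 ≤ᵐ[μ] fun x => (f x).re := by
    refine ae_nonneg_of_forall_setIntegral_nonneg hf.re fun s hs _ => ?_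
    have := (Complex.nonneg_iff.1 (h s hs)).1
    rw [← Complex.reCLM_apply, ← Complex.reCLM.integral_comp_comm hf.integrableOn] at this
    exact this
  have him : (fun x => (f x).im) =ᵐ[μ] 0 := by
    refine Integrable.ae_eq_zero_of_forall_setIntegral_eq_zero hf.im fun s hs _ => ?_
    have := (Complex.nonneg_iff.1 (h s hs)).2
    rw [← Complex.imCLM_apply, ← Complex.imCLM.integral_comp_comm hf.integrableOn] at this
    exact this.symm
  filter_upwards [hre, him] with x h1 h2
  exact Complex.nonneg_iff.2 ⟨h1, h2.symm⟩

/-- The functional of `p` integrates over a set `t` to `∫ p dρ`, where `ρ` represents the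
moment sequence `μ (φ⁻ⁿ t)`. -/
theorem _root_.UnboundedOp.GeneratesStieltjes.polynomialCondition [SigmaFinite μ]
    {hφ : QuasiMeasurePreserving φ μ μ} (hG : GeneratesStieltjes (compOp hφ)) :
    PolynomialCondition μ φ := by
  refine ⟨hG.rnDensity_lt_top, fun p hp => ae_of_forall_rnDensity_bounded hG.rnDensity_lt_top
    fun s N hs hsfin hsN => ?_⟩
  have : IsFiniteMeasure (μ.restrict s) := ⟨by rwa [restrict_apply_univ]⟩
  have hint : ∀ n, Integrable (fun x => ((rnDensity μ φ n x).toReal : ℂ)) (μ.restrict s) := by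
    intro n
    refine Integrable.ofReal (Integrable.of_bound
      (measurable_rnDensity n).ennreal_toReal.aestronglyMeasurable (N n) ?_)
    filter_upwards [ae_restrict_mem hs] with x hx
    change ‖(rnDensity μ φ n x).toReal‖ ≤ N n
    rw [Real.norm_of_nonneg ENNReal.toReal_nonneg]
    exact ENNReal.toReal_le_of_le_ofReal (Nat.cast_nonneg _) (by simpa using (hsN x hx n).le)
  refine ae_nonneg_of_forall_setIntegral_nonneg_complex
    (integrable_finsetSum _ fun n _ => (hint n).const_mul _) fun t ht => ?_
  rw [restrict_restrict ht]
  have htm := ht.inter hs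
  have hle : μ.restrict (t ∩ s) ≤ μ.restrict s := restrict_mono Set.inter_subset_right le_rfl
  have hpre : ∀ n, μ (φ^[n] ⁻¹' (t ∩ s)) < ∞ := fun n => by
    rw [measure_preimage_iterate hφ n htm]
    calc ∫⁻ x in t ∩ s, rnDensity μ φ n x ∂μ ≤ ∫⁻ _ in t ∩ s, N n ∂μ :=
          setLIntegral_mono measurable_const fun x hx => (hsN x hx.2 n).le
      _ < ∞ := by
          rw [setLIntegral_const]
          exact ENNReal.mul_lt_top (ENNReal.natCast_lt_top _)
            ((measure_mono Set.inter_subset_right).trans_lt hsfin)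
  obtain ⟨ρ, hρ⟩ := hG.isStieltjesMomentSeq_measure_preimage htm hpre
  have hm : ∀ n, (μ (φ^[n] ⁻¹' (t ∩ s))).toReal = ∫ r : ℝ≥0, (r : ℝ) ^ n ∂ρ := fun n => (hρ n).2
  have hmom : ∀ n, ∫ x in t ∩ s, ((rnDensity μ φ n x).toReal : ℂ) ∂μ =
      ∫ r : ℝ≥0, ((r : ℝ) : ℂ) ^ n ∂ρ := fun n => by
    rw [integral_complex_ofReal, integral_toReal (measurable_rnDensity n).aemeasurable
      (ae_restrict_of_ae (hG.rnDensity_lt_top n)), ← measure_preimage_iterate hφ n htm,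
      hm n, ← integral_complex_ofReal]
    simp
  have hintρ : ∀ n, Integrable (fun r : ℝ≥0 => ((r : ℝ) : ℂ) ^ n) ρ := fun n => by
    simpa using (hρ n).1.ofReal (𝕜 := ℂ)
  unfold polyFunctional
  simp_rw [Polynomial.sum]
  rw [integral_finsetSum _ fun n _ => ((hint n).mono_measure hle).const_mul _]
  simp_rw [integral_const_mul, hmom, ← integral_const_mul]
  rw [← integral_finsetSum _ fun n _ => (hintρ n).const_mul _]
  refine integral_nonneg fun r => ?_
  have := hp r r.2
  rwa [eval_eq_sum, Polynomial.sum] at this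

instance countable_polynomial_rat : Countable ℚ[X] :=
  Function.Injective.countable (f := fun p : ℚ[X] => p.toFinsupp.coeff) fun p q h => by
    ext n
    exact DFunLike.congr_fun h n

/-- To test positivity of a moment functional with nonnegative moments it suffices to use
polynomials with rational coefficients: rounding the coefficients up keeps a polynomial
nonnegative on `[0, ∞)`. -/
theorem sum_nonneg_of_forall_rat {γ : ℕ → ℝ} (hγ0 : ∀ n, 0 ≤ γ n)
    (hγ : ∀ q : ℚ[X], (∀ t : ℝ, 0 ≤ t → 0 ≤ (q.map (algebraMap ℚ ℝ)).eval t) →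
      0 ≤ (q.map (algebraMap ℚ ℝ)).sum fun n a => a * γ n)
    {p : ℝ[X]} (hp : ∀ t : ℝ, 0 ≤ t → 0 ≤ p.eval t) : 0 ≤ p.sum fun n a => a * γ n := by
  set d := p.natDegree + 1
  set S := ∑ n ∈ Finset.range d, γ n
  have hS : 0 ≤ S := Finset.sum_nonneg fun n _ => hγ0 n
  rw [p.sum_over_range' (by simp) d (Nat.lt_succ_self _)]
  refine le_of_forall_pos_lt_add fun ε hε => ?_
  -- Rounding each coefficient up by at most `δ` changes the functional by at most `δ * S < ε`.
  set δ := ε / (S + 1)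
  have hδ : 0 < δ := by positivity
  choose c hc using fun n => exists_rat_btwn (show p.coeff n < p.coeff n + δ by linarith)
  let q : ℚ[X] := ∑ n ∈ Finset.range d, monomial n (c n)
  let r : ℝ[X] := q.map (algebraMap ℚ ℝ)
  have hcoeff : ∀ n ∈ Finset.range d, r.coeff n = c n := fun n hn => by
    simp only [r, q, coeff_map, finsetSum_coeff, coeff_monomial]
    rw [Finset.sum_ite_eq' _ n, if_pos hn]
    simp
  have hdeg : r.natDegree < d := by
    refine Nat.lt_succ_of_le ((natDegree_map_le).trans (natDegree_sum_le_of_forall_le _ _ ?_))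
    exact fun n hn => (natDegree_monomial_le _).trans (Nat.lt_succ_iff.1 (Finset.mem_range.1 hn))
  have h0 := hγ q fun t ht => by
    refine (hp t ht).trans ?_
    rw [eval_eq_sum_range' (Nat.lt_succ_self p.natDegree), eval_eq_sum_range' hdeg]
    refine Finset.sum_le_sum fun n hn => ?_
    rw [hcoeff n hn]
    exact mul_le_mul_of_nonneg_right (hc n).1.le (by positivity)
  change 0 ≤ r.sum _ at h0
  rw [r.sum_over_range' (by simp) d hdeg] at h0
  have h1 : ∑ n ∈ Finset.range d, r.coeff n * γ n ≤
      ∑ n ∈ Finset.range d, (p.coeff n * γ n + δ * γ n) := by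
    refine Finset.sum_le_sum fun n hn => ?_
    rw [hcoeff n hn, ← add_mul]
    exact mul_le_mul_of_nonneg_right (hc n).2.le (hγ0 n)
  rw [Finset.sum_add_distrib, ← Finset.mul_sum] at h1
  have h2 : δ * S < ε := by
    rw [div_mul_eq_mul_div, div_lt_iff₀ (by positivity)]
    nlinarith
  exact h0.trans_lt (h1.trans_lt (by linarith))

/-- For almost every `x` the moment functional of `(h_{φ^n}(x))_n` is nonnegative on the countably
many nonnegative rational polynomials, hence on all nonnegative polynomials. -/
theorem PolynomialCondition.densityCondition (h : PolynomialCondition μ φ) :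
    DensityCondition μ φ := by
  have hq : ∀ᵐ x ∂μ, ∀ q : ℚ[X], (∀ t : ℝ, 0 ≤ t → 0 ≤ (q.map (algebraMap ℚ ℝ)).eval t) →
      0 ≤ (q.map (algebraMap ℚ ℝ)).sum fun n a => a * (rnDensity μ φ n x).toReal := by
    rw [ae_all_iff]
    intro q
    by_cases hq : ∀ t : ℝ, 0 ≤ t → 0 ≤ (q.map (algebraMap ℚ ℝ)).eval t
    · have hae := h.2 ((q.map (algebraMap ℚ ℝ)).map Complex.ofRealHom) fun t ht => by
        have := hq t ht
        rw [eval_map, ← Complex.ofRealHom_eq_coe, eval₂_at_apply]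
        exact Complex.zero_le_real.2 this
      filter_upwards [hae] with x hx _
      rw [polyFunctional, sum_def, support_map_of_injective _ Complex.ofRealHom.injective] at hx
      rw [sum_def, ← Complex.zero_le_real]
      simpa using hx
    · exact Eventually.of_forall fun x hx => absurd hx hq
  filter_upwards [hq, ae_all_iff.2 h.1] with x hx hfin
  exact ⟨hfin, StieltjesMoment.isStieltjesMomentSeq_of_nonneg fun p hp =>
    sum_nonneg_of_forall_rat (fun _ => ENNReal.toReal_nonneg) hx hp⟩

/-- For Stieltjes moment sequences with `γ 0 = 1` one has `γ k ≤ 1 + γ n` when `k ≤ n`. -/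
theorem DensityCondition.rnDensity_le [SigmaFinite μ] (h : DensityCondition μ φ) {k n : ℕ}
    (hkn : k ≤ n) : ∀ᵐ x ∂μ, rnDensity μ φ k x ≤ 1 + rnDensity μ φ n x := by
  filter_upwards [h, rnDensity_zero (μ := μ) (φ := φ)] with x ⟨hfin, ρ, hρ⟩ h0
  have hm : ∀ n, (rnDensity μ φ n x).toReal = ∫ s : ℝ≥0, (s : ℝ) ^ n ∂ρ := fun n => (hρ n).2
  rw [Pi.one_apply] at h0
  rw [← h0, ← ENNReal.toReal_le_toReal (hfin k).ne (ENNReal.add_lt_top.2 ⟨hfin 0, hfin n⟩).ne,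
    ENNReal.toReal_add (hfin 0).ne (hfin n).ne, hm k, hm 0, hm n,
    ← integral_add (hρ 0).1 (hρ n).1]
  refine integral_mono (hρ k).1 ((hρ 0).1.add (hρ n).1) fun s => ?_
  change (s : ℝ) ^ k ≤ (s : ℝ) ^ 0 + (s : ℝ) ^ n
  rw [pow_zero]
  rcases le_total (s : ℝ) 1 with hs | hs
  · exact (pow_le_one₀ s.2 hs).trans (le_add_of_nonneg_right (by positivity))
  · exact (pow_le_pow_right₀ hs hkn).trans (le_add_of_nonneg_left zero_le_one)

theorem DensityCondition.powerCoreCondition [SigmaFinite μ] (h : DensityCondition μ φ)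
    (hφ : QuasiMeasurePreserving φ μ μ) : PowerCoreCondition hφ := by
  have hfin : ∀ n, ∀ᵐ x ∂μ, rnDensity μ φ n x < ∞ := fun n => h.mono fun x hx => hx.1 n
  refine fun n => ⟨LinearPMap.ext ?_ ?_, isCore_smoothVectors hφ hfin n⟩
  · ext f
    rw [mem_pow_compOp_domain, mem_compOp_domain]
    refine ⟨fun hf => hf n le_rfl, fun hf k hk => ?_⟩
    rw [memLp_comp_iterate_iff hφ] at hf ⊢
    have hF : AEMeasurable (fun x => ‖f x‖ₑ ^ 2) μ :=
      (Lp.aestronglyMeasurable f).enorm.pow_const 2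
    calc ∫⁻ x, rnDensity μ φ k x * ‖f x‖ₑ ^ 2 ∂μ
        ≤ ∫⁻ x, (‖f x‖ₑ ^ 2 + rnDensity μ φ n x * ‖f x‖ₑ ^ 2) ∂μ := by
          refine lintegral_mono_ae ?_
          filter_upwards [h.rnDensity_le hk] with x hx
          rw [← one_add_mul]
          exact mul_le_mul_left hx _
      _ < ∞ := by
          rw [lintegral_add_left' hF, lintegral_enorm_sq_eq]
          exact ENNReal.add_lt_top.2 ⟨ENNReal.ofReal_lt_top, hf⟩
  · intro f h1 h2
    exact Lp.ext ((coeFn_pow_compOp hφ n ⟨f, h1⟩).trans (coeFn_compOp (hφ.iterate n) ⟨f, h2⟩).symm)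

end CompositionOp

/-! ### A pair of measures with the same moments -/

namespace BranchingTree

/-- The common weights `8 ^ (-m (2 m + 1))` of the two measures. -/
def weight (m : ℤ) : ℝ≥0 := 8 ^ (-(m * (2 * m + 1)))

/-- The atoms `1 + 8 ^ (-2 m)` of the first measure. -/
def branchAtom (m : ℤ) : ℝ≥0 := 1 + 8 ^ (-(2 * m))

/-- The atoms `1 + 8 ^ (2 m + 1)` of the second measure. -/
def trunkAtom (m : ℤ) : ℝ≥0 := 1 + 8 ^ (2 * m + 1)

theorem weight_pos (m : ℤ) : 0 < weight m := by unfold weight; positivity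

theorem branchAtom_pos (m : ℤ) : 0 < branchAtom m := by unfold branchAtom; positivity

theorem trunkAtom_pos (m : ℤ) : 0 < trunkAtom m := by unfold trunkAtom; positivity

theorem one_le_trunkAtom (m : ℤ) : 1 ≤ trunkAtom m := le_self_add

theorem tsum_geometric_int :
    ∑' m : ℤ, (((8 : ℝ≥0) ^ (-|m|) : ℝ≥0) : ℝ≥0∞) < ∞ := by
  rw [tsum_of_nat_of_neg_add_one ENNReal.summable ENNReal.summable]
  have h : ∑' n : ℕ, ((8 : ℝ≥0∞)⁻¹) ^ n < ∞ := by
    rw [ENNReal.tsum_geometric, ENNReal.inv_lt_top, tsub_pos_iff_lt]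
    exact ENNReal.inv_lt_one.2 (by norm_num)
  have hcoe : ∀ n : ℕ, (((8 : ℝ≥0) ^ (-(n : ℤ)) : ℝ≥0) : ℝ≥0∞) = ((8 : ℝ≥0∞)⁻¹) ^ n := fun n => by
    rw [zpow_neg, zpow_natCast, ← inv_pow, ENNReal.coe_pow, ENNReal.coe_inv (by norm_num)]
    rfl
  refine ENNReal.add_lt_top.2 ⟨?_, ?_⟩
  · simpa only [Nat.abs_cast, hcoe] using h
  · refine lt_of_le_of_lt (ENNReal.tsum_le_tsum fun n => ?_) h
    rw [← hcoe, ENNReal.coe_le_coe]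
    refine zpow_le_zpow_right₀ (by norm_num) ?_
    rw [abs_neg, abs_of_nonneg (by positivity)]
    linarith

/-- The exponent `m (2 m + 1) + 2 m k` of the `m`-th term is at least `|m| - (k + 1) ^ 2`. -/
theorem tsum_weight_mul_zpow_lt_top (k : ℕ) :
    ∑' m : ℤ, ((weight m * (8 ^ (-(2 * m))) ^ k : ℝ≥0) : ℝ≥0∞) < ∞ := by
  have hle : ∀ m : ℤ, ((weight m * (8 ^ (-(2 * m))) ^ k : ℝ≥0) : ℝ≥0∞) ≤
      ((8 ^ ((k + 1) ^ 2) : ℝ≥0) : ℝ≥0∞) * (((8 : ℝ≥0) ^ (-|m|) : ℝ≥0) : ℝ≥0∞) := fun m => by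
    rw [← ENNReal.coe_mul, ENNReal.coe_le_coe, weight, ← zpow_natCast, ← zpow_mul,
      ← zpow_add₀ (by norm_num), ← zpow_natCast, ← zpow_add₀ (by norm_num)]
    refine zpow_le_zpow_right₀ (by norm_num) ?_
    push_cast
    have h1 := neg_abs_le m
    have h2 := sq_abs m
    have h3 := abs_nonneg m
    have hk : (0 : ℤ) ≤ k := by positivity
    nlinarith [sq_nonneg (|m| - (k + 1)), mul_nonneg hk (sub_nonneg.2 h1)]
  refine (ENNReal.tsum_le_tsum hle).trans_lt ?_
  rw [ENNReal.tsum_mul_left]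
  exact ENNReal.mul_lt_top ENNReal.coe_lt_top tsum_geometric_int

/-- The substitution `m ↦ m + k` in a theta series. -/
theorem tsum_weight_mul_pow_eq (k : ℕ) :
    ∑' m : ℤ, ((weight m * (8 ^ (-(2 * m))) ^ k : ℝ≥0) : ℝ≥0∞) =
      ∑' m : ℤ, ((weight m * (8 ^ (2 * m + 1)) ^ k : ℝ≥0) : ℝ≥0∞) := by
  refine Eq.trans ?_ ((Equiv.addRight (k : ℤ)).tsum_eq _)
  refine tsum_congr fun m => ?_
  congr 1
  rw [Equiv.coe_addRight, weight, weight, ← zpow_natCast, ← zpow_natCast, ← zpow_mul, ← zpow_mul,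
    ← zpow_add₀ (by norm_num), ← zpow_add₀ (by norm_num)]
  congr 1
  ring

theorem tsum_weight_mul_one_add_pow (x : ℤ → ℝ≥0) (n : ℕ) :
    ∑' m : ℤ, ((weight m * (1 + x m) ^ n : ℝ≥0) : ℝ≥0∞) =
      ∑ k ∈ Finset.range (n + 1), (n.choose k : ℝ≥0∞) *
        ∑' m : ℤ, ((weight m * x m ^ k : ℝ≥0) : ℝ≥0∞) := by
  simp_rw [← ENNReal.tsum_mul_left]
  rw [← Summable.tsum_finsetSum fun _ _ => ENNReal.summable]
  refine tsum_congr fun m => ?_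
  rw [add_comm, add_pow, Finset.mul_sum, ENNReal.ofNNReal_finsetSum]
  refine Finset.sum_congr rfl fun k _ => ?_
  push_cast
  ring

/-- The two measures have the same moments. -/
theorem tsum_weight_mul_branchAtom_pow (n : ℕ) :
    ∑' m : ℤ, ((weight m * branchAtom m ^ n : ℝ≥0) : ℝ≥0∞) =
      ∑' m : ℤ, ((weight m * trunkAtom m ^ n : ℝ≥0) : ℝ≥0∞) := by
  unfold branchAtom trunkAtom
  rw [tsum_weight_mul_one_add_pow, tsum_weight_mul_one_add_pow]
  simp_rw [tsum_weight_mul_pow_eq]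

theorem tsum_weight_mul_trunkAtom_pow_lt_top (n : ℕ) :
    ∑' m : ℤ, ((weight m * trunkAtom m ^ n : ℝ≥0) : ℝ≥0∞) < ∞ := by
  rw [← tsum_weight_mul_branchAtom_pow]
  unfold branchAtom
  rw [tsum_weight_mul_one_add_pow, ENNReal.sum_lt_top]
  exact fun k _ => ENNReal.mul_lt_top (ENNReal.natCast_lt_top _) (tsum_weight_mul_zpow_lt_top k)

/-- The moments of order `-1` of the two measures differ: that of the first one is at least `1 / 2`,
the contribution of `m = 0` alone. -/
theorem tsum_weight_mul_trunkAtom_inv_lt :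
    ∑' m : ℤ, ((weight m * (trunkAtom m) ^ (-1 : ℤ) : ℝ≥0) : ℝ≥0∞) < 2⁻¹ := by
  rw [tsum_of_nat_of_neg_add_one ENNReal.summable ENNReal.summable]
  have hgeom : ∑' n : ℕ, ((8 : ℝ≥0∞)⁻¹) ^ (n + 1) = 7⁻¹ := by
    rw [ENNReal.tsum_geometric_add_one]
    have h : (1 : ℝ≥0∞) - 8⁻¹ = 7 * 8⁻¹ := by
      refine ENNReal.sub_eq_of_eq_add (by simp) ?_
      rw [← add_one_mul, show (7 : ℝ≥0∞) + 1 = 8 by norm_num,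
        ENNReal.mul_inv_cancel (by simp) (by simp)]
    rw [h, ENNReal.mul_inv (by simp) (by simp), inv_inv, mul_comm, mul_assoc,
      ENNReal.mul_inv_cancel (by simp) (by simp), mul_one]
  have hcoe : ∀ n : ℕ, ((8 : ℝ≥0∞)⁻¹) ^ (n + 1) = (((8 : ℝ≥0) ^ (-((n : ℤ) + 1)) : ℝ≥0) : ℝ≥0∞) := by
    intro n
    rw [zpow_neg, ← Nat.cast_succ, zpow_natCast, ← inv_pow, ENNReal.coe_pow,
      ENNReal.coe_inv (by norm_num)]
    rfl
  have h1 : ∑' n : ℕ, ((weight n * (trunkAtom n) ^ (-1 : ℤ) : ℝ≥0) : ℝ≥0∞) ≤ 7⁻¹ := by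
    rw [← hgeom]
    refine ENNReal.tsum_le_tsum fun n => ?_
    rw [hcoe, ENNReal.coe_le_coe]
    calc weight n * (trunkAtom n) ^ (-1 : ℤ)
        ≤ weight n * (8 ^ (2 * (n : ℤ) + 1)) ^ (-1 : ℤ) := by
          rw [zpow_neg_one, zpow_neg_one]
          gcongr
          exact le_add_self
      _ ≤ 8 ^ (-((n : ℤ) + 1)) := by
          rw [weight, ← zpow_mul, ← zpow_add₀ (by norm_num)]
          refine zpow_le_zpow_right₀ (by norm_num) ?_
          have hn : (0 : ℤ) ≤ n := by positivity
          nlinarith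
  have h2 : ∑' n : ℕ, ((weight (-(n + 1)) * (trunkAtom (-(n + 1))) ^ (-1 : ℤ) : ℝ≥0) : ℝ≥0∞) ≤
      7⁻¹ := by
    rw [← hgeom]
    refine ENNReal.tsum_le_tsum fun n => ?_
    rw [hcoe, ENNReal.coe_le_coe]
    calc weight (-(n + 1)) * (trunkAtom (-(n + 1))) ^ (-1 : ℤ) ≤ weight (-(n + 1)) * 1 := by
          gcongr
          rw [zpow_neg_one]
          exact inv_le_one_of_one_le₀ (one_le_trunkAtom _)
      _ ≤ 8 ^ (-((n : ℤ) + 1)) := by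
          rw [mul_one, weight]
          refine zpow_le_zpow_right₀ (by norm_num) ?_
          have hn : (0 : ℤ) ≤ n := by positivity
          nlinarith
  refine (add_le_add h1 h2).trans_lt ?_
  rw [← ENNReal.toReal_lt_toReal (by simp) (by simp), ENNReal.toReal_add (by simp) (by simp)]
  norm_num

/-! ### A weighted tree with one branching vertex -/

/-- The vertices of the tree: a trunk, with infinitely many branches at `trunk 0`. -/
inductive Vertex
  | trunk (j : ℕ)
  | branch (m : ℤ) (i : ℕ)

/-- The tree has countably infinitely many vertices. -/
def vertexEquiv : Vertex ≃ ℕ ⊕ ℤ × ℕ where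
  toFun
    | .trunk j => .inl j
    | .branch m i => .inr (m, i)
  invFun
    | .inl j => .trunk j
    | .inr (m, i) => .branch m i
  left_inv := by rintro (_ | _) <;> rfl
  right_inv := by rintro (_ | _) <;> rfl

instance : DecidableEq Vertex := vertexEquiv.decidableEq

instance : Denumerable Vertex := Denumerable.ofEquiv _ vertexEquiv

instance : MeasurableSpace Vertex := ⊤

instance : DiscreteMeasurableSpace Vertex := ⟨fun _ => trivial⟩

/-- Each vertex is moved one step along its branch towards `trunk 0`, and from there along the
trunk. -/
def parent : Vertex → Vertex
  | .trunk j => .trunk (j + 1)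
  | .branch _ 0 => .trunk 0
  | .branch m (i + 1) => .branch m i

/-- The measure (up to normalization) that represents the moment sequence of a vertex: a point mass
on the branches, and the second measure multiplied by `s ^ (-(j + 1))` on the trunk. -/
def repMeasure : Vertex → Measure ℝ≥0
  | .trunk j => Measure.sum fun m : ℤ =>
      ((weight m * trunkAtom m ^ (-((j : ℤ) + 1)) : ℝ≥0) : ℝ≥0∞) • dirac (trunkAtom m)
  | .branch m i => ((weight m * branchAtom m ^ i : ℝ≥0) : ℝ≥0∞) • dirac (branchAtom m)

/-- The moments of `repMeasure`. The one of order `0` is the mass of the vertex. -/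
def moment (n : ℕ) (d : Vertex) : ℝ≥0∞ := ∫⁻ s, (s : ℝ≥0∞) ^ n ∂(repMeasure d)

theorem moment_branch (n : ℕ) (m : ℤ) (i : ℕ) :
    moment n (.branch m i) = ((weight m * branchAtom m ^ (n + i) : ℝ≥0) : ℝ≥0∞) := by
  rw [moment, repMeasure, lintegral_smul_measure, lintegral_dirac' _ (by fun_prop), smul_eq_mul,
    add_comm n i, pow_add]
  push_cast
  ring

theorem moment_trunk (n j : ℕ) :
    moment n (.trunk j) =
      ∑' m : ℤ, ((weight m * trunkAtom m ^ ((n : ℤ) - (j + 1)) : ℝ≥0) : ℝ≥0∞) := by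
  rw [moment, repMeasure, lintegral_sum_measure]
  refine tsum_congr fun m => ?_
  rw [lintegral_smul_measure, lintegral_dirac' _ (by fun_prop), smul_eq_mul, ← ENNReal.coe_pow,
    ← ENNReal.coe_mul, mul_assoc, ← zpow_natCast, ← zpow_add₀ (trunkAtom_pos m).ne',
    neg_add_eq_sub]

theorem moment_lt_top (n : ℕ) (d : Vertex) : moment n d < ∞ := by
  cases d with
  | branch m i =>
    rw [moment_branch]
    exact ENNReal.coe_lt_top
  | trunk j =>
    rw [moment_trunk]
    refine lt_of_le_of_lt (ENNReal.tsum_le_tsum fun m => ?_) (tsum_weight_mul_trunkAtom_pow_lt_top n)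
    rw [ENNReal.coe_le_coe, ← zpow_natCast]
    gcongr
    · exact one_le_trunkAtom m
    · omega

theorem moment_pos (n : ℕ) (d : Vertex) : 0 < moment n d := by
  cases d with
  | branch m i =>
    rw [moment_branch, ENNReal.coe_pos]
    have := weight_pos m
    have := branchAtom_pos m
    positivity
  | trunk j =>
    rw [moment_trunk]
    refine lt_of_lt_of_le ?_ (ENNReal.le_tsum 0)
    rw [ENNReal.coe_pos]
    have := weight_pos 0
    have := trunkAtom_pos 0
    positivity

/-- The moments of a vertex are the sums of those of its children. At `trunk 0` this is the
equality of the moments of the two measures. -/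
theorem moment_succ (n : ℕ) (d : Vertex) :
    moment (n + 1) d = ∑' c, if parent c = d then moment n c else 0 := by
  rcases d with (_ | j) | ⟨m, i⟩
  · have hinj : Function.Injective fun m => Vertex.branch m 0 := fun m m' h => by
      cases h
      rfl
    rw [← hinj.tsum_eq, moment_trunk]
    · simp only [parent, if_true, moment_branch, add_zero, tsum_weight_mul_branchAtom_pow]
      refine tsum_congr fun m => ?_
      rw [← zpow_natCast]
      congr 3
      push_cast
      ring
    · intro c hc
      rcases c with j | ⟨m, _ | i⟩
      · simp [parent] at hc
      · exact ⟨m, rfl⟩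
      · simp [parent] at hc
  · rw [tsum_eq_single (Vertex.trunk j),
      if_pos (show parent (.trunk j) = .trunk (j + 1) from rfl), moment_trunk, moment_trunk]
    · refine tsum_congr fun m => ?_
      congr 3
      push_cast
      ring
    · intro c hc
      rw [if_neg]
      rcases c with j' | ⟨m, _ | i⟩ <;> simp_all [parent]
  · rw [tsum_eq_single (Vertex.branch m (i + 1)),
      if_pos (show parent (.branch m (i + 1)) = .branch m i from rfl),
      moment_branch, moment_branch, add_right_comm, add_assoc n i 1]
    · intro c hc
      rw [if_neg]
      rcases c with j' | ⟨m, _ | i⟩ <;> simp_all [parent]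

end BranchingTree

/-! ### Composition operators over the tree -/

namespace CompositionOp

open UnboundedOp

variable {X : Type u} [MeasurableSpace X] {μ : Measure X} {φ : X → X}

theorem isStieltjesMomentSeq_of_lintegral {γ : ℕ → ℝ} (hγ : ∀ n, 0 ≤ γ n) {ρ : Measure ℝ≥0}
    (h : ∀ n, ENNReal.ofReal (γ n) = ∫⁻ s, (s : ℝ≥0∞) ^ n ∂ρ) : IsStieltjesMomentSeq γ := by
  have hpow : ∀ n, ENNReal.ofReal (γ n) = ∫⁻ s : ℝ≥0, ENNReal.ofReal ((s : ℝ) ^ n) ∂ρ := fun n => by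
    rw [h n]
    refine lintegral_congr fun s => ?_
    rw [ENNReal.ofReal_pow (NNReal.coe_nonneg s), ENNReal.ofReal_coe_nnreal]
  have h0 : ∀ n, 0 ≤ᵐ[ρ] fun s : ℝ≥0 => (s : ℝ) ^ n := fun n =>
    Eventually.of_forall fun s => pow_nonneg s.2 n
  refine ⟨ρ, fun n => ⟨⟨by fun_prop, ?_⟩, ?_⟩⟩
  · rw [hasFiniteIntegral_iff_ofReal (h0 n), ← hpow]
    exact ENNReal.ofReal_lt_top
  · rw [integral_eq_lintegral_of_nonneg_ae (h0 n) (by fun_prop), ← hpow,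
      ENNReal.toReal_ofReal (hγ n)]

/-- The inequality `|⟪f, C g⟫| ≤ ‖C f‖ ‖g‖` for indicator functions `f` and `g`. -/
theorem measure_inter_sq_le (hφ : QuasiMeasurePreserving φ μ μ)
    (h : ∀ f g : (compOp hφ).domain,
      ‖⟪(f : Lp ℂ 2 μ), compOp hφ g⟫_ℂ‖ ≤ ‖compOp hφ f‖ * ‖(g : Lp ℂ 2 μ)‖)
    {s t : Set X} (hs : MeasurableSet s) (ht : MeasurableSet t) (hsfin : μ s ≠ ∞)
    (htfin : μ t ≠ ∞) (hsfin' : μ (φ ⁻¹' s) ≠ ∞) (htfin' : μ (φ ⁻¹' t) ≠ ∞) :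
    μ (s ∩ φ ⁻¹' t) ^ 2 ≤ μ (φ ⁻¹' s) * μ t := by
  have key : ∀ {r : Set X} (hr : MeasurableSet r) (hrfin : μ r ≠ ∞) (hrfin' : μ (φ ⁻¹' r) ≠ ∞),
      ∃ f : (compOp hφ).domain, (f : Lp ℂ 2 μ) = indicatorConstLp 2 hr hrfin (1 : ℂ) ∧
        compOp hφ f = indicatorConstLp 2 (hφ.measurable hr) hrfin' (1 : ℂ) := by
    intro r hr hrfin hrfin'
    have hae : (fun x => indicatorConstLp 2 hr hrfin (1 : ℂ) (φ x)) =ᵐ[μ]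
        indicatorConstLp 2 (hφ.measurable hr) hrfin' (1 : ℂ) :=
      (hφ.ae_eq_comp indicatorConstLp_coeFn).trans indicatorConstLp_coeFn.symm
    have hmem : indicatorConstLp 2 hr hrfin (1 : ℂ) ∈ (compOp hφ).domain :=
      (Lp.memLp (indicatorConstLp 2 (hφ.measurable hr) hrfin' (1 : ℂ))).ae_eq hae.symm
    exact ⟨⟨_, hmem⟩, rfl, Lp.ext ((coeFn_compOp hφ ⟨_, hmem⟩).trans hae)⟩
  obtain ⟨f, hf, hCf⟩ := key hs hsfin hsfin'
  obtain ⟨g, hg, hCg⟩ := key ht htfin htfin'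
  have hle := h f g
  have hnorm : ∀ {r : Set X} (hr : MeasurableSet r) (hrfin : μ r ≠ ∞),
      ‖indicatorConstLp 2 hr hrfin (1 : ℂ)‖ ^ 2 = μ.real r := fun {r} hr hrfin => by
    rw [norm_indicatorConstLp two_ne_zero ENNReal.ofNat_ne_top, norm_one, one_mul,
      ENNReal.toReal_ofNat, ← Real.sqrt_eq_rpow, Real.sq_sqrt measureReal_nonneg]
  rw [hf, hg, hCf, hCg, L2.inner_indicatorConstLp_indicatorConstLp _ _ hsfin htfin'] at hle
  have hle2 := pow_le_pow_left₀ (norm_nonneg _) hle 2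
  rw [mul_pow, hnorm, hnorm, norm_smul, Real.norm_of_nonneg measureReal_nonneg] at hle2
  simp only [inner_self_eq_norm_sq_to_K, norm_one, map_one, one_pow, mul_one] at hle2
  rw [← ENNReal.toReal_le_toReal
    (ENNReal.pow_ne_top (measure_mono Set.inter_subset_left |>.trans_lt hsfin.lt_top).ne)
    (ENNReal.mul_ne_top hsfin' htfin), ENNReal.toReal_pow, ENNReal.toReal_mul]
  exact hle2

end CompositionOp

namespace BranchingTree

open UnboundedOp CompositionOp

/-- `φ` covers the map `parent` of the tree: the fibres of `π` have measure one, and `φ` maps the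
fibre over each vertex onto the fibre over its parent in a measure preserving way. -/
structure IsModel {X : Type u} [MeasurableSpace X] (lam : Measure X) (π : X → Vertex)
    (φ : X → X) : Prop where
  measurable_proj : Measurable π
  measurable_map : Measurable φ
  measure_fibre (d : Vertex) : lam (π ⁻¹' {d}) = 1
  measure_preimage (s : Set X) (hs : MeasurableSet s) (d : Vertex) :
    lam (φ ⁻¹' s ∩ π ⁻¹' {d}) = lam (s ∩ π ⁻¹' {parent d})

namespace IsModel

variable {X : Type u} [MeasurableSpace X] {lam : Measure X} {π : X → Vertex} {φ : X → X}

/-- The measure on `X` under which the mass of the fibre over a vertex is `moment n` of it. -/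
def momentMeasure (lam : Measure X) (π : X → Vertex) (n : ℕ) : Measure X :=
  lam.withDensity fun x => moment n (π x)

theorem sigmaFinite (h : IsModel lam π φ) : SigmaFinite lam := by
  refine Measure.sigmaFinite_of_countable (S := Set.range fun d => π ⁻¹' {d})
    (Set.countable_range _) ?_ ?_
  · rintro _ ⟨d, rfl⟩
    rw [h.measure_fibre]
    exact ENNReal.one_lt_top
  · exact Set.eq_univ_of_forall fun x => ⟨_, ⟨π x, rfl⟩, rfl⟩

theorem measurableSet_fibre (h : IsModel lam π φ) (d : Vertex) : MeasurableSet (π ⁻¹' {d}) :=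
  h.measurable_proj (measurableSet_singleton d)

theorem measurable_moment (h : IsModel lam π φ) (n : ℕ) : Measurable fun x => moment n (π x) :=
  (measurable_of_countable (moment n)).comp h.measurable_proj

theorem lintegral_momentMeasure (h : IsModel lam π φ) (n : ℕ) {g : X → ℝ≥0∞}
    (hg : Measurable g) :
    ∫⁻ x, g x ∂(momentMeasure lam π n) = ∑' d, moment n d * ∫⁻ x in π ⁻¹' {d}, g x ∂lam := by
  have hU : ⋃ d, π ⁻¹' {d} = Set.univ := Set.eq_univ_of_forall fun x => Set.mem_iUnion.2 ⟨π x, rfl⟩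
  rw [momentMeasure, lintegral_withDensity_eq_lintegral_mul _ (h.measurable_moment n) hg,
    ← setLIntegral_univ, ← hU,
    lintegral_iUnion h.measurableSet_fibre
      fun d d' hd => Disjoint.preimage π (Set.disjoint_singleton.2 hd)]
  refine tsum_congr fun d => ?_
  rw [← lintegral_const_mul _ hg]
  exact setLIntegral_congr_fun (h.measurableSet_fibre d) fun x hx => by
    rw [Pi.mul_apply, show π x = d from hx]

theorem momentMeasure_apply (h : IsModel lam π φ) (n : ℕ) {s : Set X} (hs : MeasurableSet s) :
    momentMeasure lam π n s = ∑' d, moment n d * lam (s ∩ π ⁻¹' {d}) := by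
  rw [← lintegral_indicator_one hs, h.lintegral_momentMeasure n (measurable_one.indicator hs)]
  refine tsum_congr fun d => ?_
  rw [lintegral_indicator_one hs, restrict_apply hs]

theorem momentMeasure_fibre (h : IsModel lam π φ) (n : ℕ) (d : Vertex) :
    momentMeasure lam π n (π ⁻¹' {d}) = moment n d := by
  rw [h.momentMeasure_apply n (h.measurableSet_fibre d), tsum_eq_single d, Set.inter_self,
    h.measure_fibre, mul_one]
  intro d' hd
  rw [(Disjoint.preimage π (Set.disjoint_singleton.2 hd.symm)).inter_eq, measure_empty, mul_zero]

theorem map_momentMeasure (h : IsModel lam π φ) (n : ℕ) :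
    (momentMeasure lam π n).map φ = momentMeasure lam π (n + 1) := by
  ext s hs
  rw [map_apply h.measurable_map hs, h.momentMeasure_apply n (h.measurable_map hs),
    h.momentMeasure_apply (n + 1) hs]
  simp_rw [h.measure_preimage s hs, moment_succ, ← ENNReal.tsum_mul_right]
  rw [ENNReal.tsum_comm]
  refine tsum_congr fun c => ?_
  rw [tsum_eq_single (parent c), if_pos rfl]
  intro d hd
  rw [if_neg hd.symm, zero_mul]

theorem map_iterate_momentMeasure (h : IsModel lam π φ) (n : ℕ) :
    (momentMeasure lam π 0).map φ^[n] = momentMeasure lam π n := by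
  induction n with
  | zero => rw [Function.iterate_zero, Measure.map_id]
  | succ n ih =>
    rw [Function.iterate_succ', ← Measure.map_map h.measurable_map (h.measurable_map.iterate n), ih,
      h.map_momentMeasure]

theorem sigmaFinite_momentMeasure (h : IsModel lam π φ) (n : ℕ) :
    SigmaFinite (momentMeasure lam π n) :=
  have := h.sigmaFinite
  SigmaFinite.withDensity_of_ne_top (Eventually.of_forall fun _ => (moment_lt_top n _).ne)

theorem absolutelyContinuous_momentMeasure (h : IsModel lam π φ) (n : ℕ) :
    lam ≪ momentMeasure lam π n :=
  withDensity_absolutelyContinuous' (h.measurable_moment n).aemeasurable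
    (Eventually.of_forall fun _ => (moment_pos n _).ne')

theorem momentMeasure_absolutelyContinuous (n : ℕ) : momentMeasure lam π n ≪ lam :=
  withDensity_absolutelyContinuous _ _

theorem quasiMeasurePreserving (h : IsModel lam π φ) :
    QuasiMeasurePreserving φ (momentMeasure lam π 0) (momentMeasure lam π 0) := by
  refine ⟨h.measurable_map, ?_⟩
  rw [h.map_momentMeasure]
  exact (momentMeasure_absolutelyContinuous _).trans (h.absolutelyContinuous_momentMeasure 0)

theorem rnDensity_lt_top (h : IsModel lam π φ) (n : ℕ) :
    ∀ᵐ x ∂(momentMeasure lam π 0), rnDensity (momentMeasure lam π 0) φ n x < ∞ := by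
  have := h.sigmaFinite_momentMeasure n
  rw [← h.map_iterate_momentMeasure] at this
  exact rnDeriv_lt_top _ _

/-- `‖C_φ ^ n f‖ ^ 2` is the `n`-th moment of the sum of the representing measures of the vertices,
weighted by the squared norms of `f` on the fibres. -/
theorem generatesStieltjes (h : IsModel lam π φ) :
    GeneratesStieltjes (compOp h.quasiMeasurePreserving) := by
  have := h.sigmaFinite_momentMeasure 0
  have hφ := h.quasiMeasurePreserving
  refine ⟨dense_smoothVectors hφ h.rnDensity_lt_top, fun f hf => ?_⟩
  refine isStieltjesMomentSeq_of_lintegral (ρ := Measure.sum fun d =>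
    (∫⁻ x in π ⁻¹' {d}, ‖f x‖ₑ ^ 2 ∂lam) • repMeasure d) (fun n => sq_nonneg _) fun n => ?_
  have hfm : Measurable fun x => ‖f x‖ₑ ^ 2 := (Lp.stronglyMeasurable f).enorm.pow_const 2
  rw [ofReal_norm_pow_compOp_sq, ← lintegral_comp_iterate hφ n hfm.aemeasurable,
    ← lintegral_map hfm (h.measurable_map.iterate n), h.map_iterate_momentMeasure,
    h.lintegral_momentMeasure n hfm, lintegral_sum_measure]
  refine tsum_congr fun d => ?_
  rw [lintegral_smul_measure, smul_eq_mul, mul_comm]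
  rfl

/-- The necessary condition for hyponormality fails for the fibres over the first vertex of the
branch with index `0` and over `trunk 0`. -/
theorem not_norm_inner_le (h : IsModel lam π φ) :
    ¬ ∀ f g : (compOp h.quasiMeasurePreserving).domain,
      ‖⟪(f : Lp ℂ 2 (momentMeasure lam π 0)), compOp h.quasiMeasurePreserving g⟫_ℂ‖ ≤
        ‖compOp h.quasiMeasurePreserving f‖ * ‖(g : Lp ℂ 2 (momentMeasure lam π 0))‖ := by
  intro H
  have hfin : ∀ d, momentMeasure lam π 0 (π ⁻¹' {d}) ≠ ∞ := fun d => by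
    rw [h.momentMeasure_fibre]
    exact (moment_lt_top 0 d).ne
  have hpre : ∀ d, momentMeasure lam π 0 (φ ⁻¹' (π ⁻¹' {d})) = moment 1 d := fun d => by
    rw [← map_apply h.measurable_map (h.measurableSet_fibre d), h.map_momentMeasure,
      h.momentMeasure_fibre]
  have hfin' : ∀ d, momentMeasure lam π 0 (φ ⁻¹' (π ⁻¹' {d})) ≠ ∞ := fun d => by
    rw [hpre]
    exact (moment_lt_top 1 d).ne
  have hle := measure_inter_sq_le h.quasiMeasurePreserving H
    (h.measurableSet_fibre (.branch 0 0)) (h.measurableSet_fibre (.trunk 0))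
    (hfin _) (hfin _) (hfin' _) (hfin' _)
  have h1 : momentMeasure lam π 0 (π ⁻¹' {.branch 0 0} ∩ φ ⁻¹' (π ⁻¹' {.trunk 0})) = 1 := by
    rw [h.momentMeasure_apply 0 ((h.measurableSet_fibre _).inter
      (h.measurable_map (h.measurableSet_fibre _))), tsum_eq_single (.branch 0 0)]
    · rw [Set.inter_comm, ← Set.inter_assoc, Set.inter_self, Set.inter_comm,
        h.measure_preimage _ (h.measurableSet_fibre _), parent, Set.inter_self, h.measure_fibre,
        moment_branch]
      simp [weight]
    · intro d hd
      have : π ⁻¹' {Vertex.branch 0 0} ∩ φ ⁻¹' (π ⁻¹' {Vertex.trunk 0}) ∩ π ⁻¹' {d} = ∅ :=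
        Set.eq_empty_of_forall_notMem fun x hx => hd (hx.2.symm.trans hx.1.1)
      rw [this, measure_empty, mul_zero]
  have h2 : moment 1 (.branch 0 0) = 2 := by
    rw [moment_branch]
    simp [weight, branchAtom, one_add_one_eq_two]
  have h3 : moment 0 (.trunk 0) < 2⁻¹ := by
    rw [moment_trunk]
    simpa using tsum_weight_mul_trunkAtom_inv_lt
  rw [h1, hpre, h2, h.momentMeasure_fibre, one_pow] at hle
  refine not_lt.2 hle ?_
  calc 2 * moment 0 (.trunk 0) < 2 * 2⁻¹ := ENNReal.mul_lt_mul_right (by simp) (by simp) h3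
    _ = 1 := ENNReal.mul_inv_cancel (by simp) (by simp)

theorem isLambertCounterexample (h : IsModel lam π φ) :
    IsLambertCounterexample.{u, v} h.quasiMeasurePreserving := by
  have := h.sigmaFinite_momentMeasure 0
  have hG := h.generatesStieltjes
  have hD := hG.polynomialCondition.densityCondition
  exact ⟨hG, hD, hG.setCondition, hG.polynomialCondition, hD.powerCoreCondition _,
    fun hS => h.not_norm_inner_le hS.norm_inner_le, fun hH => h.not_norm_inner_le hH.norm_inner_le⟩

end IsModel

/-- A numbering of the vertices. -/
def number : Vertex ≃ ℕ := Denumerable.eqv Vertex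

/-- The transformation of `ℕ` that corresponds to `parent`. -/
def natMap (n : ℕ) : ℕ := number (parent (number.symm n))

theorem isModel_nat : IsModel (count : Measure ℕ) number.symm natMap where
  measurable_proj := measurable_of_countable _
  measurable_map := measurable_of_countable _
  measure_fibre d := by
    have : number.symm ⁻¹' {d} = {number d} := by
      ext n
      simp [Equiv.symm_apply_eq]
    rw [this, count_singleton]
  measure_preimage s _ d := by
    have h1 : number.symm ⁻¹' {d} = {number d} := by
      ext n
      simp [Equiv.symm_apply_eq]
    have h2 : number.symm ⁻¹' {parent d} = {number (parent d)} := by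
      ext n
      simp [Equiv.symm_apply_eq]
    rw [h1, h2]
    by_cases hd : number (parent d) ∈ s
    · rw [Set.inter_singleton_of_mem hd, Set.inter_singleton_of_mem, count_singleton,
        count_singleton]
      simpa [natMap] using hd
    · rw [Set.inter_singleton_eq_empty.2 hd, Set.inter_singleton_eq_empty.2]
      simpa [natMap] using hd

/-- The vertex attached to the interval `[n, n + 1)` that contains a point. -/
def intervalVertex (x : Set.Ici (0 : ℝ)) : Vertex := number.symm ⌊(x : ℝ)⌋₊

/-- The transformation of `[0, ∞)` that translates `[n, n + 1)` onto
`[natMap n, natMap n + 1)`. -/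
def intervalMap (x : Set.Ici (0 : ℝ)) : Set.Ici (0 : ℝ) :=
  ⟨natMap ⌊(x : ℝ)⌋₊ + ((x : ℝ) - ⌊(x : ℝ)⌋₊),
    Set.mem_Ici.2 (add_nonneg (Nat.cast_nonneg _) (sub_nonneg.2 (Nat.floor_le x.2)))⟩

theorem mem_fibre_iff {x : Set.Ici (0 : ℝ)} {d : Vertex} :
    x ∈ intervalVertex ⁻¹' {d} ↔ (number d : ℝ) ≤ x ∧ (x : ℝ) < number d + 1 := by
  rw [← Nat.floor_eq_iff x.2]
  simp [intervalVertex, Equiv.symm_apply_eq]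

theorem isModel_interval :
    IsModel ((volume : Measure ℝ).comap Subtype.val) intervalVertex intervalMap where
  measurable_proj := (measurable_of_countable number.symm).comp
    (Nat.measurable_floor.comp measurable_subtype_coe)
  measurable_map := by
    have h1 : Measurable fun x : Set.Ici (0 : ℝ) => ⌊(x : ℝ)⌋₊ :=
      Nat.measurable_floor.comp measurable_subtype_coe
    have h2 : Measurable fun n : ℕ => (n : ℝ) := measurable_of_countable _
    have h3 : Measurable fun n : ℕ => (natMap n : ℝ) := measurable_of_countable _
    have h4 : Measurable fun x : Set.Ici (0 : ℝ) =>
        (natMap ⌊(x : ℝ)⌋₊ : ℝ) + ((x : ℝ) - ⌊(x : ℝ)⌋₊) :=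
      (h3.comp h1).add (measurable_subtype_coe.sub (h2.comp h1))
    exact h4.subtype_mk
  measure_fibre d := by
    rw [comap_subtype_coe_apply measurableSet_Ici]
    have : Subtype.val '' (intervalVertex ⁻¹' {d}) = Set.Ico (number d : ℝ) (number d + 1) := by
      ext t
      constructor
      · rintro ⟨x, hx, rfl⟩
        exact mem_fibre_iff.1 hx
      · intro ht
        exact ⟨⟨t, (Nat.cast_nonneg _).trans ht.1⟩, mem_fibre_iff.2 ht, rfl⟩
    rw [this, Real.volume_Ico]
    simp
  measure_preimage s _ d := by
    rw [comap_subtype_coe_apply measurableSet_Ici, comap_subtype_coe_apply measurableSet_Ici]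
    set c : ℝ := (number (parent d) : ℝ) - number d with hc
    have hfloor : ∀ x : Set.Ici (0 : ℝ), x ∈ intervalVertex ⁻¹' {d} →
        (intervalMap x : ℝ) = x + c := by
      intro x hx
      have : ⌊(x : ℝ)⌋₊ = number d := (Nat.floor_eq_iff x.2).2 (mem_fibre_iff.1 hx)
      simp only [intervalMap, this, natMap, Equiv.symm_apply_apply, hc]
      ring
    rw [← measure_preimage_add_right volume c (Subtype.val '' (s ∩ intervalVertex ⁻¹' {parent d}))]
    congr 1
    ext t
    constructor
    · rintro ⟨x, ⟨hxs, hxd⟩, rfl⟩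
      refine ⟨intervalMap x, ⟨hxs, ?_⟩, hfloor x hxd⟩
      rw [mem_fibre_iff, hfloor x hxd, hc]
      have := mem_fibre_iff.1 hxd
      constructor <;> linarith
    · rintro ⟨y, ⟨hys, hyd⟩, hy⟩
      have hy' := mem_fibre_iff.1 hyd
      change (y : ℝ) = t + c at hy
      have ht : (number d : ℝ) ≤ t ∧ t < number d + 1 := by
        constructor <;> linarith
      have hxd : (⟨t, (Nat.cast_nonneg _).trans ht.1⟩ : Set.Ici (0 : ℝ)) ∈
          intervalVertex ⁻¹' {d} := mem_fibre_iff.2 ht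
      refine ⟨_, ⟨?_, hxd⟩, rfl⟩
      have : intervalMap ⟨t, (Nat.cast_nonneg _).trans ht.1⟩ = y :=
        Subtype.ext ((hfloor _ hxd).trans hy.symm)
      rwa [Set.mem_preimage, this]

end BranchingTree

end

theorem mainTheorem3 :
    -- a discrete example
    (∃ (μ : Measure ℕ) (φ : ℕ → ℕ) (hφ : QuasiMeasurePreserving φ μ μ),
      (∀ n, 0 < μ {n} ∧ μ {n} < ∞) ∧ SigmaFinite μ ∧
        CompositionOp.IsLambertCounterexample.{0, v} hφ) ∧
    -- an example over a measure equivalent to the Lebesgue measure on `[0, ∞)`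
    (∃ (μ : Measure (Set.Ici (0 : ℝ))) (φ : Set.Ici (0 : ℝ) → Set.Ici (0 : ℝ))
        (hφ : QuasiMeasurePreserving φ μ μ),
      μ ≪ (volume : Measure ℝ).comap Subtype.val ∧
        (volume : Measure ℝ).comap Subtype.val ≪ μ ∧ SigmaFinite μ ∧
        CompositionOp.IsLambertCounterexample.{0, v} hφ) ∧
    -- the moment conditions hold for each `C_φ` that generates Stieltjes moment sequences
    (∀ (X : Type u) [MeasurableSpace X] (μ : Measure X) [SigmaFinite μ] (φ : X → X)
        (hφ : QuasiMeasurePreserving φ μ μ),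
      UnboundedOp.GeneratesStieltjes (CompositionOp.compOp hφ) →
        CompositionOp.DensityCondition μ φ ∧ CompositionOp.SetCondition hφ ∧
          CompositionOp.PolynomialCondition μ φ ∧ CompositionOp.PowerCoreCondition hφ) ∧
    -- none of the moment conditions implies subnormality
    (¬ ∀ (X : Type) [MeasurableSpace X] (μ : Measure X) [SigmaFinite μ] (φ : X → X)
        (hφ : QuasiMeasurePreserving φ μ μ),
      UnboundedOp.GeneratesStieltjes (CompositionOp.compOp hφ) →
        UnboundedOp.IsSubnormal.{0, v} (CompositionOp.compOp hφ)) ∧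
    (¬ ∀ (X : Type) [MeasurableSpace X] (μ : Measure X) [SigmaFinite μ] (φ : X → X)
        (hφ : QuasiMeasurePreserving φ μ μ),
      CompositionOp.DensityCondition μ φ →
        UnboundedOp.IsSubnormal.{0, v} (CompositionOp.compOp hφ)) ∧
    (¬ ∀ (X : Type) [MeasurableSpace X] (μ : Measure X) [SigmaFinite μ] (φ : X → X)
        (hφ : QuasiMeasurePreserving φ μ μ),
      CompositionOp.SetCondition hφ →
        UnboundedOp.IsSubnormal.{0, v} (CompositionOp.compOp hφ)) ∧
    (¬ ∀ (X : Type) [MeasurableSpace X] (μ : Measure X) [SigmaFinite μ] (φ : X → X)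
        (hφ : QuasiMeasurePreserving φ μ μ),
      CompositionOp.PolynomialCondition μ φ →
        UnboundedOp.IsSubnormal.{0, v} (CompositionOp.compOp hφ)) := by
  have hN := BranchingTree.isModel_nat
  have := hN.sigmaFinite_momentMeasure 0
  obtain ⟨hG, hD, hS, hP, hC, hnS, hnH⟩ := hN.isLambertCounterexample.{0, v}
  refine ⟨⟨_, _, hN.quasiMeasurePreserving, fun n => ?_, this,
      hG, hD, hS, hP, hC, hnS, hnH⟩, ?_, fun X _ μ _ φ hφ hG => ?_,
    fun h => hnS (h _ _ _ _ hG), fun h => hnS (h _ _ _ hN.quasiMeasurePreserving hD),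
    fun h => hnS (h _ _ _ _ hS), fun h => hnS (h _ _ _ hN.quasiMeasurePreserving hP)⟩
  · have hn : ({n} : Set ℕ) = BranchingTree.number.symm ⁻¹' {BranchingTree.number.symm n} := by
      ext k
      simp
    rw [hn, hN.momentMeasure_fibre]
    exact ⟨BranchingTree.moment_pos _ _, BranchingTree.moment_lt_top _ _⟩
  · have hI := BranchingTree.isModel_interval
    exact ⟨_, _, hI.quasiMeasurePreserving,
      BranchingTree.IsModel.momentMeasure_absolutelyContinuous 0,
      hI.absolutelyContinuous_momentMeasure 0, hI.sigmaFinite_momentMeasure 0,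
      hI.isLambertCounterexample⟩
  · have hP := hG.polynomialCondition
    exact ⟨hP.densityCondition, hG.setCondition, hP, hP.densityCondition.powerCoreCondition hφ⟩
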